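/- For polynomials $p,q\in\mathbb C[z]$ put $\{p,q\}_2=p''q-4p'q'+4pq''$. Consider the recurrence relations $$q_{i+1}'q_i-q_{i+1}q_i'=(3i+1)\,p_i,\qquad p_i'p_{i-1}-p_ip_{i-1}'=(6i-1)\,q_i^4,\qquad i\in\mathbb Z,$$ with $p_{-1}=z$, $p_0=q_0=1$, $q_1=z$. (1) All solutions are polynomials, and the recurrences can always be solved. Precisely: arrange the unknowns in the order $\dots,p_{-1},q_0,p_0,q_1,p_1,q_2,\dots$. Suppose that holomorphic functions on a domain $U\subseteq\mathbb C$ are given at the places of an interval of this order (possibly the whole order) containing $p_{-1},q_0,p_0,q_1$, that they have the initial values above, and that they satisfy on $U$ all the relations that involve only given functions. Then they are the restrictions to $U$ of members of a solution $(p_i,q_i)_{i\in\mathbb Z}$ consisting of polynomials. (2) For every polynomial solution $(p_i,q_i)_{i\in\mathbb Z}$ and every $i\in\mathbb Z$, the polynomials $p_i,q_i$ are monic, with $$\deg p_i=i(3i+2),\qquad \deg q_i=\frac{i(3i-1)}2,\qquad \{p_i,q_i\}_2=\{p_i,q_{i+1}\}_2=0 .$$ (3) Let $p,q\in\mathbb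 C[z]$ be nonzero polynomials with no common and no repeated roots, let $x_1,\dots,x_n$ be the roots of $p$ and $y_1,\dots,y_m$ the roots of $q$. The following are equivalent: (a) $\{p,q\}_2=0$; (b) up to nonzero constant factors in $p$ and $q$ and a common translation $z\mapsto z+c$, one has $p=p_i,\ q=q_i$ or $p=p_i,\ q=q_{i+1}$ for some $i\in\mathbb Z$ and some polynomial solution $(p_j,q_j)_{j\in\mathbb Z}$ of the recurrence relations with the initial values above; (c) both indefinite integrals $\int \frac{p}{q^2}\,dz$ and $\int\frac{q^4}{p^2}\,dz$ are rational functions; (d) the energy $E(z_1,\dots,z_{n+m})=\sum_{i<j}Q_iQ_j\log|z_i-z_j|$ with $Q_i=1$ for $i\le n$ and $Q_i=-2$ for $i>n$, as a real function on $\mathbb C^{n+m}$, has a critical point at $(x_1,\dots,x_n,y_1,\dots,y_m)$. -/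

import Mathlib

open Polynomial

namespace ChargeEquilibrium

noncomputable section

/-- The bilinear expression `{p, q}_Λ = p'' q - 2 Λ p' q' + Λ² p q''`. -/
def bracket (Λ : ℂ) (p q : ℂ[X]) : ℂ[X] :=
  derivative (derivative p) * q - C (2 * Λ) * (derivative p * derivative q)
    + C (Λ ^ 2) * (p * derivative (derivative q))

/-- The indefinite integral `∫ (num / den) dz` is rational: some rational function `a / b` is an
antiderivative of `num / den` at all points where neither has a vanishing denominator. -/
def HasRationalIntegral (num den : ℂ[X]) : Prop :=
  ∃ a b : ℂ[X], b ≠ 0 ∧ ∀ z : ℂ, b.eval z ≠ 0 → den.eval z ≠ 0 →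
    HasDerivAt (fun w : ℂ => a.eval w / b.eval w) (num.eval z / den.eval z) z

/-- The charges: the first `n` are equal to `1`, the last `m` are equal to `-2`. -/
def charge (n m : ℕ) (i : Fin (n + m)) : ℝ := if (i : ℕ) < n then 1 else -2

/-- The energy `∑_{i < j} Q_i Q_j log |z_i - z_j|`, a real function of `n + m` complex variables. -/
def energy (n m : ℕ) (z : Fin (n + m) → ℂ) : ℝ :=
  ∑ i, ∑ j ∈ Finset.Ioi i, charge n m i * charge n m j * Real.log ‖z i - z j‖

/-- `z` is a critical point of the energy: the energy is (real) differentiable at `z`, with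
vanishing differential. -/
def IsEquilibrium (n m : ℕ) (z : Fin (n + m) → ℂ) : Prop :=
  HasFDerivAt (𝕜 := ℝ) (energy n m) (0 : (Fin (n + m) → ℂ) →L[ℝ] ℝ) z

/-- Holomorphic solutions on `U` of the recurrence relations with the given initial data,
possibly only for part of the indices. The functions are arranged in the order in which the
recurrences determine them, `…, p₋₁, q₀, p₀, q₁, p₁, …`, where `q i` has position `2 * i` and `p i`
has position `2 * i + 1`; `I` is the set of positions at which the functions are given
(`I = Set.univ` for a solution defined for all indices), and a relation is imposed whenever all
the functions that occur in it are given. -/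
structure IsSolutionOn (U : Set ℂ) (I : Set ℤ) (p q : ℤ → ℂ → ℂ) : Prop where
  holo_p : ∀ i : ℤ, 2 * i + 1 ∈ I → DifferentiableOn ℂ (p i) U
  holo_q : ∀ i : ℤ, 2 * i ∈ I → DifferentiableOn ℂ (q i) U
  p_neg_one : ∀ z ∈ U, p (-1) z = z
  q_zero : ∀ z ∈ U, q 0 z = 1
  p_zero : ∀ z ∈ U, p 0 z = 1
  q_one : ∀ z ∈ U, q 1 z = z
  rel_q : ∀ i : ℤ, 2 * i ∈ I → 2 * i + 1 ∈ I → 2 * i + 2 ∈ I → ∀ z ∈ U,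
    deriv (q (i + 1)) z * q i z - q (i + 1) z * deriv (q i) z = ((3 * i + 1 : ℤ) : ℂ) * p i z
  rel_p : ∀ i : ℤ, 2 * i - 1 ∈ I → 2 * i ∈ I → 2 * i + 1 ∈ I → ∀ z ∈ U,
    deriv (p i) z * p (i - 1) z - p i z * deriv (p (i - 1)) z
      = ((6 * i - 1 : ℤ) : ℂ) * q i z ^ 4

/-- Polynomial solutions of the recurrence relations, for all integer indices, with the given
initial data. -/
structure IsPolynomialSolution (p q : ℤ → ℂ[X]) : Prop where
  p_neg_one : p (-1) = X
  q_zero : q 0 = 1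
  p_zero : p 0 = 1
  q_one : q 1 = X
  rel_q : ∀ i : ℤ, derivative (q (i + 1)) * q i - q (i + 1) * derivative (q i)
    = C ((3 * i + 1 : ℤ) : ℂ) * p i
  rel_p : ∀ i : ℤ, derivative (p i) * p (i - 1) - p i * derivative (p (i - 1))
    = C ((6 * i - 1 : ℤ) : ℂ) * q i ^ 4

/-- Up to nonzero constant factors and a translation of the variable, `(p, q)` is one of the pairs
`(p_i, q_i)`, `(p_i, q_{i+1})` of a polynomial solution of the recurrence relations. -/
def IsRecurrencePair (p q : ℂ[X]) : Prop :=
  ∃ (P Q : ℤ → ℂ[X]) (i : ℤ) (a b c : ℂ), IsPolynomialSolution P Q ∧ a ≠ 0 ∧ b ≠ 0 ∧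
    p = C a * (P i).comp (X + C c) ∧
    (q = C b * (Q i).comp (X + C c) ∨ q = C b * (Q (i + 1)).comp (X + C c))

end

end ChargeEquilibrium

/-! For fixed `g` the bilinear equation is a second order linear equation in `f`. By Abel's identity
the Wronskian of two solutions is a constant multiple of `g ^ e`, and conversely a `u` whose
Wronskian with a nonzero solution `f` is such a multiple is again a solution (`ibracket_of_wr`). The
recurrences perform this exchange of one solution for another alternately in the two arguments, with
exponents 4 and 1.

The new member `f ∫ g ^ e / f²` is a polynomial if `f` has simple roots and all residues vanish; the
residues vanish because of the bilinear equation modulo `f`. For special constants of integration,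
however, roots collide. Pairs are therefore regarded as values at `s = 0` of pairs over `ℂ⟦s⟧` that
are separable and coprime over the fraction field (`IsGood`). The Wronskian equation is solved
there, the denominators are removed (`exists_wr_eq_of_generic`), and a perturbed constant of
integration keeps the property (`IsGood.of_wr`). A holomorphic solution of one step differs from a
polynomial one by a constant multiple of `f`, so it is polynomial too. Degrees follow from the
leading coefficient of the Wronskian.

Conversely, the top coefficient of the bilinear equation gives `(a - 2 b)² = a + 4 b` for `a = deg
p`, `b = deg q`. Unless both are constant, one exchange lowers a degree; descending to constants and
reading backwards yields a chain (`IsGood.exists_isChain`), and a translation normalizes its linear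
member.

Finally, for separable coprime `p`, `q` the bracket has degree below that of `p q`, so it vanishes
once it vanishes at all roots. These root conditions say that the residues of both integrands
vanish, and, through `p'' / (2 p') = ∑ 1 / (x - x_j)` and `q' / q = ∑ 1 / (x - y_j)`, that the
forces on all charges vanish. -/

namespace ChargeEquilibrium

/-! ### Wronskians and the bilinear equation over a commutative ring. -/

section CommRing
variable {A B : Type*} [CommRing A] [CommRing B]

/-- The Wronskian `f' g - f g'`. -/
noncomputable def wr (f g : A[X]) : A[X] := derivative f * g - f * derivative g

/-- The bilinear expression `4 f'' g - 4 e f' g' + e² f g''`, proportional to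
`bracket (e / 2) f g`. -/
noncomputable def ibracket (e : ℕ) (f g : A[X]) : A[X] :=
  4 * (derivative (derivative f) * g) - 4 * e * (derivative f * derivative g)
    + e ^ 2 * (f * derivative (derivative g))

lemma map_wr (φ : A →+* B) (f g : A[X]) : (wr f g).map φ = wr (f.map φ) (g.map φ) := by
  simp [wr, derivative_map]

lemma map_ibracket (φ : A →+* B) (e : ℕ) (f g : A[X]) :
    (ibracket e f g).map φ = ibracket e (f.map φ) (g.map φ) := by
  simp [ibracket, derivative_map]

lemma wr_add_C_mul (f g : A[X]) (t : A) : wr (f + C t * g) g = wr f g := by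
  simp only [wr, derivative_add, derivative_C_mul]; ring

lemma wr_C_mul_left (f g : A[X]) (t : A) : wr (C t * f) g = C t * wr f g := by
  simp only [wr, derivative_C_mul]; ring

lemma wr_C_mul_right (f g : A[X]) (t : A) : wr f (C t * g) = C t * wr f g := by
  simp only [wr, derivative_C_mul]; ring

lemma wr_sub (f₁ f₂ g : A[X]) : wr (f₁ - f₂) g = wr f₁ g - wr f₂ g := by
  simp only [wr, derivative_sub]; ring

lemma wr_comm (f g : A[X]) : wr f g = - wr g f := by
  simp only [wr]; ring

lemma wr_comp_X_add_C (f g : A[X]) (t : A) :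
    wr (f.comp (X + C t)) (g.comp (X + C t)) = (wr f g).comp (X + C t) := by
  simp [wr, derivative_comp]

/-- In characteristic zero the factor `n - m` is nonzero for distinct degrees, so the Wronskian then
has exactly the expected degree; all degree computations rest on this. For `n = m = 0` the truncated
index is `0` and both sides vanish. -/
lemma coeff_wr {f g : A[X]} {n m : ℕ} (hf : f.natDegree ≤ n) (hg : g.natDegree ≤ m) :
    (wr f g).coeff (n + m - 1) = (n - m : A) * (f.coeff n * g.coeff m) := by
  have h1 : (derivative f * g).coeff (n + m - 1) = n * (f.coeff n * g.coeff m) := by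
    rcases n with _ | n
    · rw [natDegree_eq_zero.1 (Nat.le_zero.1 hf) |>.choose_spec.symm]; simp
    · have := coeff_mul_add_eq_of_natDegree_le (df := n) (dg := m)
        ((natDegree_derivative_le f).trans (by lia)) hg
      rw [show n + 1 + m - 1 = n + m by lia, this, coeff_derivative]; push_cast; ring
  have h2 : (f * derivative g).coeff (n + m - 1) = m * (f.coeff n * g.coeff m) := by
    rcases m with _ | m
    · rw [natDegree_eq_zero.1 (Nat.le_zero.1 hg) |>.choose_spec.symm]; simp
    · have := coeff_mul_add_eq_of_natDegree_le (df := n) (dg := m) hf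
        ((natDegree_derivative_le g).trans (by lia))
      rw [show n + (m + 1) - 1 = n + m by lia, this, coeff_derivative]; push_cast; ring
  rw [wr, coeff_sub, h1, h2]; ring

lemma natDegree_wr_le (f g : A[X]) : (wr f g).natDegree ≤ f.natDegree + g.natDegree - 1 := by
  have aux : ∀ u v : A[X], (derivative u * v).natDegree ≤ u.natDegree + v.natDegree - 1 := by
    intro u v
    rcases Nat.eq_zero_or_pos u.natDegree with h | h
    · rw [derivative_of_natDegree_zero h]; simp
    · refine natDegree_mul_le.trans ?_
      have := natDegree_derivative_le u
      lia
  refine (natDegree_sub_le _ _).trans (max_le (aux f g) ?_)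
  rw [mul_comm, add_comm]; exact aux g f

lemma ibracket_C_mul (e : ℕ) (f g : A[X]) (a b : A) :
    ibracket e (C a * f) (C b * g) = C (a * b) * ibracket e f g := by
  simp only [ibracket, derivative_C_mul, C_mul]; ring

/-- The exponents 1 and 4 are dual: the equation for `f` given `g` with one exponent is the equation
for `g` given `f` with the other. This lets a chain alternate between its two kinds of members. -/
lemma ibracket_swap {e e' : ℕ} (he : e * e' = 4) (f g : A[X]) :
    4 * ibracket e' g f = e' ^ 2 * ibracket e f g := by
  have h : (e : A[X]) * e' = 4 := by exact_mod_cast congrArg (Nat.cast : ℕ → A[X]) he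
  simp only [ibracket]
  linear_combination (-((e' : A[X]) * e + 4) * (f * derivative (derivative g))
    + 4 * e' * (derivative f * derivative g)) * h

/-- If `f` satisfies the second order equation determined by `g`, then so does any `u` whose
Wronskian with `f` is proportional to `g ^ e`. -/
lemma ibracket_of_wr [IsDomain A] {e : ℕ} {f g u : A[X]} {c : A} (hf : f ≠ 0)
    (he : 1 ≤ e)
    (h : ibracket e f g = 0) (hw : wr u f = C c * g ^ e) : ibracket e u g = 0 := by
  obtain ⟨e, rfl⟩ := Nat.exists_eq_add_of_le' he
  have hd : derivative (wr u f) = C c * ((e + 1) * g ^ e * derivative g) := by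
    rw [hw]; simp [derivative_pow]
  have hd' : derivative (wr u f)
      = derivative (derivative u) * f - u * derivative (derivative f) := by
    simp only [wr, derivative_sub, derivative_mul]; ring
  -- After multiplication by `f`, the equation for `u` is a combination of the equation for `f`, the
  -- Wronskian relation and its derivative.
  have h0 : f * ibracket (e + 1) u g = 0 := by
    rw [hd'] at hd
    simp only [wr] at hw
    simp only [ibracket] at h ⊢
    push_cast at h ⊢
    linear_combination u * h + 4 * g * hd - 4 * (e + 1) * derivative g * hw
  exact (mul_eq_zero.1 h0).resolve_left hf

end CommRing

/-! ### Coprimality, separability and solvability of Wronskian equations over a field. -/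

section Field
variable {K : Type*} [Field K]

/-- In a pencil `u + t f` with `f` coprime to `g`, almost all members are coprime to `g`. -/
lemma exists_isCoprime_add {ι : Type*} [Infinite ι] {τ : ι → K} (hτ : Function.Injective τ)
    {f g u : K[X]} (hg : g ≠ 0) (hfg : IsCoprime f g) : ∃ i, IsCoprime (u + C (τ i) * f) g := by
  classical
  by_contra! hcon
  have hex : ∀ i, ∃ π ∈ (UniqueFactorizationMonoid.normalizedFactors g).toFinset,
      π ∣ u + C (τ i) * f := by
    intro i
    by_contra! hπ
    refine hcon i (isCoprime_of_prime_dvd (fun h => hg h.2) ?_)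
    intro z hz hz1 hz2
    obtain ⟨q, hq, hzq⟩ := UniqueFactorizationMonoid.exists_mem_normalizedFactors_of_dvd hg
      hz.irreducible hz2
    exact hπ q (Multiset.mem_toFinset.2 hq) ((hzq.dvd_iff_dvd_left).1 hz1)
  choose π hπ hdvd using hex
  -- `g` has finitely many prime factors, so two members of the pencil share one; it divides their
  -- difference, hence `f`, against coprimality.
  obtain ⟨i, j, hij, hpi⟩ := Finite.exists_ne_map_eq_of_infinite
    (fun i => (⟨π i, hπ i⟩ : (UniqueFactorizationMonoid.normalizedFactors g).toFinset))
  have hpi' : π i = π j := congrArg Subtype.val hpi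
  have hmem := Multiset.mem_toFinset.1 (hπ i)
  have hpr := UniqueFactorizationMonoid.prime_of_normalized_factor _ hmem
  have h1 : π i ∣ C (τ i - τ j) * f := by
    have := dvd_sub (hdvd i) (hpi' ▸ hdvd j)
    convert this using 1
    rw [C_sub]; ring
  have h2 : IsUnit (C (τ i - τ j)) :=
    isUnit_C.2 (isUnit_iff_ne_zero.2 (sub_ne_zero.2 fun h => hij (hτ h)))
  have h3 : π i ∣ f := (h2.dvd_mul_left).1 h1
  exact hpr.not_isUnit (hfg.isUnit_of_dvd' h3
    (UniqueFactorizationMonoid.dvd_of_mem_normalizedFactors hmem))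

/-- A common factor of `u` and `u'` divides the Wronskian, hence `g ^ e`, and `u` is coprime to `g`.
-/
lemma separable_of_wr {f g u : K[X]} {c : K} {e : ℕ} (hc : c ≠ 0) (h : wr u f = C c * g ^ e)
    (hu : IsCoprime u g) : u.Separable := by
  have h1 : IsCoprime u (derivative u * f) := by
    have h2 : IsCoprime u (C c * g ^ e) :=
      (isCoprime_mul_unit_left_right (isUnit_C.2 (isUnit_iff_ne_zero.2 hc)) _ _).2 hu.pow_right
    have h3 : derivative u * f = C c * g ^ e + u * derivative f := by
      rw [← h, wr]; ring
    rw [h3]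
    exact h2.add_mul_left_right _
  exact h1.of_mul_right_left

variable [CharZero K]

/-- Nonzero polynomials of distinct degrees have nonzero Wronskian. For equal degrees, subtracting
the multiple of `g` that cancels the leading term reduces to that case. -/
lemma exists_eq_C_mul_of_wr_eq_zero {f g : K[X]} (hg : g ≠ 0) (h : wr f g = 0) :
    ∃ t, f = C t * g := by
  have key : ∀ u : K[X], wr u g = 0 → u.natDegree ≠ g.natDegree → u = 0 := by
    intro u hu hne
    by_contra h0
    have := coeff_wr (le_refl u.natDegree) (le_refl g.natDegree)
    rw [hu, coeff_zero] at this
    have h1 : (u.natDegree - g.natDegree : K) ≠ 0 := sub_ne_zero.2 (by exact_mod_cast hne)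
    exact mul_ne_zero h1 (mul_ne_zero (leadingCoeff_ne_zero.2 h0) (leadingCoeff_ne_zero.2 hg))
      this.symm
  by_cases hd : f.natDegree = g.natDegree
  · have hg' : g.leadingCoeff ≠ 0 := leadingCoeff_ne_zero.2 hg
    by_cases hf : f = 0
    · exact ⟨0, by simp [hf]⟩
    have hf' : f.leadingCoeff ≠ 0 := leadingCoeff_ne_zero.2 hf
    set t := f.leadingCoeff / g.leadingCoeff with ht
    have ht0 : t ≠ 0 := div_ne_zero hf' hg'
    refine ⟨t, sub_eq_zero.1 ?_⟩
    by_contra hne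
    have hlt : (f - C t * g).degree < f.degree := by
      apply degree_sub_lt_left _ hf
      · rw [leadingCoeff_mul, leadingCoeff_C, ht]; field_simp
      · rw [degree_C_mul ht0, degree_eq_natDegree hf, degree_eq_natDegree hg, hd]
    refine hne (key _ ?_ ?_)
    · rw [wr_sub, h, wr_C_mul_left]; simp [wr, mul_comm]
    · have := natDegree_lt_natDegree hne hlt
      lia
  · exact ⟨0, by simpa using key f h hd⟩

lemma monic_of_wr {f g h : K[X]} {e n m N : ℕ} (hg : g.Monic) (hh : h.Monic)
    (hgm : g.natDegree = m) (hhn : h.natDegree = n) (hN : N + m = e * n + 1) (hmN : m < N)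
    (hw : wr f g = C ((N : K) - m) * h ^ e) : f.Monic ∧ f.natDegree = N := by
  have hc : (N : K) - m ≠ 0 := sub_ne_zero.2 (by exact_mod_cast hmN.ne')
  have hdeg : (wr f g).natDegree = e * n := by
    rw [hw, natDegree_C_mul hc, natDegree_pow, hhn]
  have hlead : (wr f g).coeff (e * n) = N - m := by
    have := (hh.pow e).coeff_natDegree
    rw [natDegree_pow, hhn] at this
    rw [hw, coeff_C_mul, this, mul_one]
  have hf0 : f.leadingCoeff ≠ 0 := by
    rw [leadingCoeff_ne_zero]
    rintro rfl
    simp [wr] at hlead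
    exact hc hlead.symm
  have hco := coeff_wr (le_refl f.natDegree) (le_refl g.natDegree)
  rw [hg.coeff_natDegree, coeff_natDegree, mul_one, hgm] at hco
  have hle := natDegree_wr_le f g
  rw [hdeg, hgm] at hle
  by_cases hd : f.natDegree = m
  · exfalso
    rw [hd] at hco hle
    -- For `m ≥ 1` the bounds already conflict, since `e * n ≥ 2 * m`; for `m = 0` the truncated
    -- right side is `0`.
    have : e * n = m + m - 1 := by lia
    rw [← this, hlead, sub_self, zero_mul] at hco
    exact hc hco
  · have h1 : (f.natDegree - m : K) ≠ 0 := sub_ne_zero.2 (by exact_mod_cast hd)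
    have h2 := le_natDegree_of_ne_zero (hco.trans_ne (mul_ne_zero h1 hf0))
    have h3 : f.natDegree = N := by lia
    refine ⟨?_, h3⟩
    rw [h3, show N + m - 1 = e * n by lia, hlead] at hco
    rw [Monic]
    exact mul_left_cancel₀ hc (by rw [← hco, mul_one])

lemma exists_derivative_eq (f : K[X]) : ∃ F, derivative F = f := by
  induction f using Polynomial.induction_on' with
  | add p q hp hq =>
    obtain ⟨P, rfl⟩ := hp
    obtain ⟨Q, rfl⟩ := hq
    exact ⟨P + Q, derivative_add⟩
  | monomial n a =>
    refine ⟨monomial (n + 1) (a / (n + 1)), ?_⟩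
    rw [derivative_monomial]
    congr 1
    push_cast
    field_simp

/-- If `f / g²` has no residues, then it has an antiderivative of the form `a / g`. -/
lemma exists_wr_eq {f g : K[X]} (hg : g.Separable)
    (h : g ∣ derivative f * derivative g - f * derivative (derivative g)) :
    ∃ a, wr a g = f := by
  obtain ⟨u, v, huv⟩ := hg
  -- Modulo `g` the Wronskian of `a` and `g` is `-a g'`, so the Bézout relation `u g + v g' = 1`
  -- suggests this `a`. It removes the double poles; the hypothesis on residues then makes the
  -- remainder `b / g` a polynomial, which is integrated.
  set a := -(f * v) with ha
  set b := f * u - derivative a with hb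
  have h1 : f = wr a g + g * b := by
    simp only [wr, hb, ha]; linear_combination -f * huv
  have h2 : g ∣ b * derivative g ^ 2 := by
    have e1 : derivative f = derivative (derivative a) * g - a * derivative (derivative g)
        + derivative g * b + g * derivative b := by
      conv_lhs => rw [h1]
      simp only [wr, derivative_add, derivative_sub, derivative_mul]; ring
    have e2 : b * derivative g ^ 2 = (derivative f * derivative g - f * derivative (derivative g))
      - g * (derivative (derivative a) * derivative g + derivative b * derivative g
        - derivative a * derivative (derivative g) - b * derivative (derivative g)) := by
      rw [e1]
      conv_rhs => rw [h1]
      simp only [wr]; ring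
    rw [e2]
    exact dvd_sub h (dvd_mul_right _ _)
  have hco : IsCoprime g (derivative g ^ 2) := IsCoprime.pow_right ⟨u, v, huv⟩
  have h3 : g ∣ b := hco.dvd_of_dvd_mul_right h2
  obtain ⟨k, hk⟩ := h3
  obtain ⟨k', rfl⟩ := exists_derivative_eq k
  refine ⟨a + g * k', ?_⟩
  conv_rhs => rw [h1, hk]
  simp only [wr, derivative_add, derivative_mul]; ring

/-- This is the vanishing of the residues of `g ^ e / f²`: modulo `f` the bilinear equation reads `g
f'' = e f' g'`. -/
lemma dvd_of_ibracket {e : ℕ} (he : 1 ≤ e) {f g : K[X]} (h : ibracket e f g = 0) :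
    f ∣ derivative (g ^ e) * derivative f - g ^ e * derivative (derivative f) := by
  obtain ⟨e, rfl⟩ := Nat.exists_eq_add_of_le' he
  have h4 : f ∣ 4 * (derivative (g ^ (e + 1)) * derivative f
      - g ^ (e + 1) * derivative (derivative f)) := by
    refine ⟨g ^ e * (e + 1) ^ 2 * derivative (derivative g), ?_⟩
    simp only [ibracket] at h
    push_cast at h
    simp only [derivative_pow, Nat.cast_add, Nat.cast_one, map_add, map_one, map_natCast,
      Nat.add_sub_cancel]
    linear_combination -g ^ e * h
  have h4' : IsUnit (4 : K[X]) := by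
    rw [show (4 : K[X]) = C 4 by rfl, isUnit_C]; exact isUnit_iff_ne_zero.2 (by norm_num)
  exact (h4'.dvd_mul_left).1 h4

end Field

/-! ### Deformation over `ℂ⟦s⟧` to pairs without common or repeated roots. -/

section Good
/-- The specialization of polynomials over `ℂ⟦s⟧` at `s = 0`. -/
noncomputable abbrev special (f : (PowerSeries ℂ)[X]) : ℂ[X] := f.map PowerSeries.constantCoeff

/-- The extension of scalars of polynomials over `ℂ⟦s⟧` to the fraction field. -/
noncomputable abbrev generic (f : (PowerSeries ℂ)[X]) : (FractionRing (PowerSeries ℂ))[X] :=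
  f.map (algebraMap (PowerSeries ℂ) (FractionRing (PowerSeries ℂ)))

lemma generic_injective : Function.Injective generic :=
  map_injective _ (IsFractionRing.injective _ _)

lemma exists_eq_C_X_mul {f : (PowerSeries ℂ)[X]} (h : special f = 0) :
    ∃ f', f = C PowerSeries.X * f' := by
  have : C (PowerSeries.X : PowerSeries ℂ) ∣ f := by
    rw [C_dvd_iff_dvd_coeff]
    intro i
    rw [PowerSeries.X_dvd_iff]
    simpa using congrArg (coeff · i) h
  exact this

/-- Modulo `s` the Wronskian vanishes, so `f` reduces to a constant multiple of `g`. Subtracting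
this multiple leaves the Wronskian unchanged and makes `f` divisible by `s`, which lowers the power
by one. -/
lemma exists_wr_eq_of_X_pow {g r : (PowerSeries ℂ)[X]} (hg : special g ≠ 0) (k : ℕ) :
    ∀ f, wr f g = C (PowerSeries.X ^ k) * r → ∃ f', wr f' g = r := by
  induction k with
  | zero => intro f hf; exact ⟨f, by simpa using hf⟩
  | succ k ih =>
    intro f hf
    obtain ⟨t, ht⟩ := exists_eq_C_mul_of_wr_eq_zero (f := special f) hg (by
      rw [special, special, ← map_wr, hf]; simp)
    obtain ⟨f', hf'⟩ := exists_eq_C_X_mul (f := f + C (-PowerSeries.C t) * g) (by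
      simp [special] at ht ⊢; rw [ht]; ring)
    refine ih f' ?_
    have h1 := wr_add_C_mul f g (-PowerSeries.C t)
    rw [hf', hf, wr_C_mul_left, pow_succ', C_mul, mul_assoc] at h1
    exact mul_left_cancel₀ (C_ne_zero.2 PowerSeries.X_ne_zero) h1

lemma exists_wr_eq_of_generic {g r : (PowerSeries ℂ)[X]} (hg : special g ≠ 0)
    {a : (FractionRing (PowerSeries ℂ))[X]} (ha : wr a (generic g) = generic r) :
    ∃ f, wr f g = r := by
  obtain ⟨b, hb, hab⟩ :=
    IsLocalization.integerNormalization_spec (nonZeroDivisors (PowerSeries ℂ)) a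
  set f := IsLocalization.integerNormalization (nonZeroDivisors (PowerSeries ℂ)) a
  have hb0 : b ≠ 0 := nonZeroDivisors.ne_zero hb
  have h1 : wr f g = C b * r := by
    apply generic_injective
    have h2 : generic f = C (algebraMap _ _ b) * a := by
      rw [← smul_eq_C_mul, algebraMap_smul]
      exact hab
    rw [generic, map_wr, ← generic, ← generic, h2, wr_C_mul_left, ha]
    simp [generic]
  obtain ⟨n, u, hu⟩ := IsDiscreteValuationRing.eq_unit_mul_pow_irreducible hb0
    (PowerSeries.X_prime (R := ℂ)).irreducible
  refine exists_wr_eq_of_X_pow hg n (C (↑u⁻¹ : PowerSeries ℂ) * f) ?_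
  rw [wr_C_mul_left, h1, hu, ← mul_assoc, ← C_mul, ← mul_assoc, Units.inv_mul, one_mul]

/-- A pair of polynomials that is the specialization of a pair over `ℂ⟦s⟧` which satisfies the
bilinear equation and has no common and no repeated roots over the fraction field. -/
def IsGood (e : ℕ) (f g : ℂ[X]) : Prop :=
  f ≠ 0 ∧ g ≠ 0 ∧ ∃ F G : (PowerSeries ℂ)[X], special F = f ∧ special G = g ∧
    ibracket e F G = 0 ∧ (generic F).Separable ∧ (generic G).Separable ∧
    IsCoprime (generic F) (generic G)

variable {e e' : ℕ} {f g u : ℂ[X]}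

lemma IsGood.ibracket_eq_zero (h : IsGood e f g) : ibracket e f g = 0 := by
  obtain ⟨-, -, F, G, rfl, rfl, h, -⟩ := h
  rw [special, special, ← map_ibracket, h, Polynomial.map_zero]

lemma ibracket_eq_zero_swap {A : Type*} [CommRing A] [IsDomain A] [CharZero A]
    (he : e * e' = 4) {f g : A[X]} (h : ibracket e f g = 0) : ibracket e' g f = 0 := by
  have := ibracket_swap he f g
  rw [h, mul_zero] at this
  exact (mul_eq_zero.1 this).resolve_left (by norm_num)

lemma IsGood.swap (he : e * e' = 4) (h : IsGood e f g) : IsGood e' g f := by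
  obtain ⟨hf, hg, F, G, hF, hG, hB, hsF, hsG, hc⟩ := h
  have : CharZero (PowerSeries ℂ) := algebraRat.charZero _
  exact ⟨hg, hf, G, F, hG, hF, ibracket_eq_zero_swap he hB, hsG, hsF, hc.symm⟩

lemma isGood_of_separable (hf : f.Separable) (hg : g.Separable) (hfg : IsCoprime f g)
    (h : ibracket e f g = 0) : IsGood e f g := by
  refine ⟨hf.ne_zero, hg.ne_zero, f.map PowerSeries.C, g.map PowerSeries.C, ?_, ?_, ?_, ?_, ?_, ?_⟩
  · rw [special, map_map]; convert Polynomial.map_id; ext; simp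
  · rw [special, map_map]; convert Polynomial.map_id; ext; simp
  · rw [← map_ibracket, h, Polynomial.map_zero]
  · rw [generic, map_map]; exact hf.map
  · rw [generic, map_map]; exact hg.map
  · rw [generic, map_map, generic, map_map]; exact (isCoprime_map _).2 hfg

lemma charZero_fractionRing : CharZero (FractionRing (PowerSeries ℂ)) := by
  have : CharZero (PowerSeries ℂ) := algebraRat.charZero _
  exact IsFractionRing.charZero (PowerSeries ℂ)

/-- Separability is needed only over the fraction field, and the descent to `ℂ⟦s⟧` needs only
`special F ≠ 0`; collisions of roots at `s = 0` are thus harmless. -/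
lemma exists_lift {F G : (PowerSeries ℂ)[X]} (he : 1 ≤ e) (hF : special F ≠ 0)
    (hB : ibracket e F G = 0) (hs : (generic F).Separable) : ∃ U, wr U F = G ^ e := by
  have := charZero_fractionRing
  obtain ⟨a, ha⟩ := exists_wr_eq hs (dvd_of_ibracket he
    (show ibracket e (generic F) (generic G) = 0 by
      rw [generic, generic, ← map_ibracket, hB, Polynomial.map_zero]))
  exact exists_wr_eq_of_generic hF (a := a) (by rw [ha]; simp [generic])

lemma IsGood.exists_wr_eq (he : 1 ≤ e) (h : IsGood e f g) : ∃ u, wr u f = g ^ e := by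
  obtain ⟨hf, hg, F, G, rfl, rfl, hB, hsF, hsG, hc⟩ := h
  obtain ⟨U, hU⟩ := exists_lift he hf hB hsF
  exact ⟨special U, by rw [special, special, ← map_wr, hU]; simp⟩

/-- The property is inherited by the second solution of the bilinear equation, whichever
constants of integration are chosen. -/
lemma IsGood.of_wr (he : 1 ≤ e) (h : IsGood e f g) {c : ℂ} (hc0 : c ≠ 0)
    (hu : wr u f = C c * g ^ e) : IsGood e u g := by
  have hK := charZero_fractionRing
  obtain ⟨hf, hg, F, G, rfl, rfl, hB, hsF, hsG, hc⟩ := h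
  obtain ⟨U₀, hU₀⟩ := exists_lift he hf hB hsF
  set U := C (PowerSeries.C c) * U₀ with hUdef
  have hU : wr U F = C (PowerSeries.C c) * G ^ e := by rw [hUdef, wr_C_mul_left, hU₀]
  obtain ⟨t, ht⟩ := exists_eq_C_mul_of_wr_eq_zero (f := u - special U) hf (by
    rw [wr_sub, hu, special, special, ← map_wr, hU]; simp)
  -- The constant term `t` makes the deformation specialize to the given `u`; the coefficient `a` of
  -- `s` remains free and is chosen to obtain coprimality over the fraction field.
  let τ : ℂ → PowerSeries ℂ := fun a => PowerSeries.C t + PowerSeries.C a * PowerSeries.X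
  have hτ : Function.Injective τ := by
    intro a b hab
    have := congrArg (PowerSeries.coeff 1) hab
    simpa [τ, PowerSeries.coeff_C] using this
  obtain ⟨a, ha⟩ := exists_isCoprime_add
    (τ := fun a => algebraMap _ (FractionRing (PowerSeries ℂ)) (τ a))
    ((IsFractionRing.injective (PowerSeries ℂ) (FractionRing (PowerSeries ℂ))).comp hτ)
    (u := generic U) hsG.ne_zero hc
  have hV : generic (U + C (τ a) * F)
      = generic U + C (algebraMap _ (FractionRing (PowerSeries ℂ)) (τ a)) * generic F := by
    simp [generic]
  have hw : wr (U + C (τ a) * F) F = C (PowerSeries.C c) * G ^ e := by rw [wr_add_C_mul, hU]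
  have hF0 : F ≠ 0 := by rintro rfl; simp at hf
  refine ⟨?_, hg, U + C (τ a) * F, G, ?_, rfl, ibracket_of_wr hF0 he hB hw, ?_, hsG, ?_⟩
  · rintro rfl
    simp only [wr, derivative_zero, zero_mul, sub_zero] at hu
    exact mul_ne_zero (C_ne_zero.2 hc0) (pow_ne_zero _ hg) hu.symm
  · have h1 : special (U + C (τ a) * F) = special U + C t * special F := by
      simp [special, τ]
    rw [h1, ← ht]; ring
  · refine separable_of_wr (f := generic F) (g := generic G) (e := e)
      (c := algebraMap _ _ (PowerSeries.C c)) ?_ ?_ (hV ▸ ha)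
    · exact (map_ne_zero_iff _ (IsFractionRing.injective _ _)).2
        ((map_ne_zero_iff _ PowerSeries.C_injective).2 hc0)
    · rw [generic, generic, ← map_wr, hw]; simp [generic]
  · exact hV ▸ ha

end Good

/-! ### One-sided chains of polynomials and holomorphic functions. -/

section Chains
lemma exists_seq_of_step {α : Type*} {Inv : ℕ → α → α → Prop} {Rel : ℕ → α → α → α → Prop}
    {a b : α} (h0 : Inv 0 a b)
    (step : ∀ k f g, Inv k f g → ∃ u, Inv (k + 1) g u ∧ Rel k f g u) :
    ∃ h : ℕ → α, h 0 = a ∧ h 1 = b ∧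
      ∀ k, Inv k (h k) (h (k + 1)) ∧ Rel k (h k) (h (k + 1)) (h (k + 2)) := by
  choose! F hF using step
  let s : (k : ℕ) → {x : α × α // Inv k x.1 x.2} := fun k =>
    Nat.rec ⟨(a, b), h0⟩ (fun k x => ⟨(x.1.2, F k x.1.1 x.1.2), (hF k _ _ x.2).1⟩) k
  exact ⟨fun k => (s k).1.1, rfl, rfl, fun k => ⟨(s k).2, (hF k _ _ (s k).2).2⟩⟩

/-- The exponents and the degrees in a one-sided chain of polynomials. -/
structure IsChainType (e d : ℕ → ℕ) : Prop where
  exp_mul : ∀ k, e k * e (k + 1) = 4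
  deg_zero : d 0 = 0
  deg_one : d 1 = 0
  deg_add : ∀ k, d (k + 2) + d k = e (k + 1) * d (k + 1) + 1
  deg_lt : ∀ k, d k < d (k + 2)

/-- One-sided chains of polynomials which start with `1, 1` and are linked by their
Wronskians. -/
structure IsChain (e d : ℕ → ℕ) (h : ℕ → ℂ[X]) : Prop where
  zero : h 0 = 1
  one : h 1 = 1
  wr_eq : ∀ k, wr (h (k + 2)) (h k) = C ((d (k + 2) : ℂ) - d k) * h (k + 1) ^ e (k + 1)

variable {e d : ℕ → ℕ}

lemma IsChainType.exp_pos (T : IsChainType e d) (k : ℕ) : 1 ≤ e k := by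
  have := T.exp_mul k
  rcases Nat.eq_zero_or_pos (e k) with h | h
  · simp [h] at this
  · exact h

lemma IsChainType.coeff_ne_zero (T : IsChainType e d) (k : ℕ) : (d (k + 2) : ℂ) - d k ≠ 0 :=
  sub_ne_zero.2 (by exact_mod_cast (T.deg_lt k).ne')

lemma IsChain.monic_and_natDegree (T : IsChainType e d) {h : ℕ → ℂ[X]} (hc : IsChain e d h)
    (k : ℕ) : (h k).Monic ∧ (h k).natDegree = d k := by
  suffices ∀ k, ((h k).Monic ∧ (h k).natDegree = d k) ∧
      ((h (k + 1)).Monic ∧ (h (k + 1)).natDegree = d (k + 1)) from (this k).1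
  intro k
  induction k with
  | zero => simp [hc.zero, hc.one, T.deg_zero, T.deg_one]
  | succ k ih =>
    refine ⟨ih.2, monic_of_wr ih.1.1 ih.2.1 ih.1.2 ih.2.2 (T.deg_add k) (T.deg_lt k)
      (hc.wr_eq k)⟩

lemma ibracket_one_one {A : Type*} [CommRing A] (e : ℕ) : ibracket e (1 : A[X]) 1 = 0 := by
  simp [ibracket]

lemma IsChain.ibracket_eq_zero (T : IsChainType e d) {h : ℕ → ℂ[X]} (hc : IsChain e d h)
    (k : ℕ) : ibracket (e (k + 1)) (h k) (h (k + 1)) = 0 := by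
  induction k with
  | zero => rw [hc.zero, zero_add, hc.one, ibracket_one_one]
  | succ k ih =>
    exact ibracket_eq_zero_swap (T.exp_mul _) (ibracket_of_wr
      (hc.monic_and_natDegree T k).1.ne_zero (T.exp_pos _) ih (hc.wr_eq k))

lemma isGood_one_one (e : ℕ) : IsGood e 1 1 :=
  isGood_of_separable separable_one separable_one isCoprime_one_left (ibracket_one_one e)

lemma deriv_eq_of_eqOn {U : Set ℂ} (hU : IsOpen U) {u : ℂ → ℂ} {f : ℂ[X]}
    (h : ∀ z ∈ U, u z = f.eval z) {z : ℂ} (hz : z ∈ U) :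
    deriv u z = (derivative f).eval z := by
  rw [Filter.EventuallyEq.deriv_eq (f := fun z => f.eval z)
    (Filter.eventually_of_mem (hU.mem_nhds hz) h), Polynomial.deriv]

lemma exists_eval_ne_zero {U : Set ℂ} (hU : IsOpen U) (hne : U.Nonempty) {f : ℂ[X]}
    (hf : f ≠ 0) : ∃ z ∈ U, f.eval z ≠ 0 := by
  by_contra! hcon
  obtain ⟨z, hz⟩ := hne
  exact hf (eq_zero_of_infinite_isRoot f
    ((infinite_of_mem_nhds z (hU.mem_nhds hz)).mono fun w hw => hcon w hw))

lemma eq_of_eval_eqOn {U : Set ℂ} (hU : IsOpen U) (hne : U.Nonempty) {f g : ℂ[X]}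
    (h : ∀ z ∈ U, f.eval z = g.eval z) : f = g := by
  by_contra hfg
  obtain ⟨z, hz, h0⟩ := exists_eval_ne_zero hU hne (sub_ne_zero.2 hfg)
  exact h0 (by rw [eval_sub, h z hz, sub_self])

/-- A holomorphic function on a domain whose Wronskian with the polynomial `f` agrees with that of
the polynomial `u₀` differs from `u₀` by a multiple of `f`. -/
lemma exists_eq_eval_add_of_wr {U : Set ℂ} (hU : IsOpen U) (hconn : IsConnected U) {u : ℂ → ℂ}
    (hu : DifferentiableOn ℂ u U) {f u₀ : ℂ[X]} (hf : f ≠ 0)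
    (h : ∀ z ∈ U, deriv u z * f.eval z - u z * (derivative f).eval z = (wr u₀ f).eval z) :
    ∃ t : ℂ, ∀ z ∈ U, u z = (u₀ + C t * f).eval z := by
  obtain ⟨z₀, hz₀, hfz⟩ := exists_eval_ne_zero hU hconn.nonempty hf
  set t := (u z₀ - u₀.eval z₀) / f.eval z₀ with ht
  have hopen : IsOpen (U ∩ {z | f.eval z ≠ 0}) :=
    hU.inter (isOpen_ne_fun f.continuous continuous_const)
  obtain ⟨r, hr, hball⟩ := Metric.isOpen_iff.1 hopen z₀ ⟨hz₀, hfz⟩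
  have hder : ∀ z ∈ Metric.ball z₀ r,
      HasDerivAt (fun w => (u w - u₀.eval w) / f.eval w) 0 z := by
    intro z hz
    obtain ⟨hzU, hz0⟩ := hball hz
    have h1 := (hu.differentiableAt (hU.mem_nhds hzU)).hasDerivAt
    refine ((h1.sub (u₀.hasDerivAt z)).div (f.hasDerivAt z) hz0).congr_deriv ?_
    have h2 := h z hzU
    simp only [wr, eval_sub, eval_mul] at h2
    rw [div_eq_zero_iff]
    left
    simp only [Pi.sub_apply]
    linear_combination h2
  have hconst : ∀ z ∈ Metric.ball z₀ r, (u z - u₀.eval z) / f.eval z = t := by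
    intro z hz
    exact (convex_ball z₀ r).is_const_of_fderivWithin_eq_zero (𝕜 := ℂ)
      (f := fun w => (u w - u₀.eval w) / f.eval w)
      (fun w hw => (hder w hw).differentiableAt.differentiableWithinAt)
      (fun w hw => by
        rw [((hder w hw).hasFDerivAt.hasFDerivWithinAt).fderivWithin
          (Metric.isOpen_ball.uniqueDiffWithinAt hw)]
        ext; simp)
      hz (Metric.mem_ball_self hr)
  have hana : AnalyticOnNhd ℂ (fun z => u z - (u₀ + C t * f).eval z) U := by
    refine DifferentiableOn.analyticOnNhd ?_ hU
    exact hu.sub (Polynomial.differentiable _).differentiableOn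
  -- The quotient is constant on a ball free of zeros of `f`; the identity theorem carries the
  -- equality to all of `U`, zeros of `f` included.
  refine ⟨t, fun z hz => sub_eq_zero.1 (hana.eqOn_zero_of_preconnected_of_eventuallyEq_zero
    hconn.isPreconnected hz₀ ?_ hz)⟩
  filter_upwards [Metric.ball_mem_nhds z₀ hr] with z hz
  have h1 := hconst z hz
  rw [div_eq_iff (hball hz).2] at h1
  simp only [eval_add, eval_mul, eval_C, Pi.zero_apply]
  linear_combination h1

/-- Every holomorphic chain, given on an initial segment `J` of the indices, consists of
polynomials and extends to a complete chain of polynomials. -/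
lemma exists_isChain (T : IsChainType e d) {U : Set ℂ} (hU : IsOpen U) (hconn : IsConnected U)
    {J : Set ℕ} (hJ : ∀ k, k + 1 ∈ J → k ∈ J) {u : ℕ → ℂ → ℂ}
    (hu : ∀ k ∈ J, DifferentiableOn ℂ (u k) U) (h0 : ∀ z ∈ U, u 0 z = 1)
    (h1 : ∀ z ∈ U, u 1 z = 1)
    (hrel : ∀ k, k + 2 ∈ J → ∀ z ∈ U,
      deriv (u (k + 2)) z * u k z - u (k + 2) z * deriv (u k) z
        = ((d (k + 2) : ℂ) - d k) * u (k + 1) z ^ e (k + 1)) :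
    ∃ h, IsChain e d h ∧ ∀ k ∈ J, ∀ z ∈ U, u k z = (h k).eval z := by
  refine Exists.elim (exists_seq_of_step
    (Inv := fun k (f g : ℂ[X]) => IsGood (e (k + 1)) f g ∧ (k ∈ J → ∀ z ∈ U, u k z = f.eval z) ∧
      (k + 1 ∈ J → ∀ z ∈ U, u (k + 1) z = g.eval z))
    (Rel := fun k f g v => wr v f = C ((d (k + 2) : ℂ) - d k) * g ^ e (k + 1))
    (a := 1) (b := 1) ⟨isGood_one_one _, fun _ z hz => by simp [h0 z hz],
      fun _ z hz => by simp [h1 z hz]⟩ ?_) ?_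
  · rintro k f g ⟨hgood, hf, hg⟩
    obtain ⟨v, hv⟩ := hgood.exists_wr_eq (T.exp_pos _)
    set v₀ := C ((d (k + 2) : ℂ) - d k) * v with hv₀
    have hw : wr v₀ f = C ((d (k + 2) : ℂ) - d k) * g ^ e (k + 1) := by
      rw [hv₀, wr_C_mul_left, hv]
    -- The constant of integration is dictated by the given function where there is one, and is `0`
    -- beyond `J`.
    obtain ⟨t, ht⟩ : ∃ t : ℂ, k + 2 ∈ J → ∀ z ∈ U, u (k + 2) z = (v₀ + C t * f).eval z := by
      by_cases hk : k + 2 ∈ J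
      · obtain ⟨t, ht⟩ := exists_eq_eval_add_of_wr hU hconn (hu _ hk) (u₀ := v₀) hgood.1 (by
          intro z hz
          have hk1 := hJ _ hk
          have := hrel k hk z hz
          rw [deriv_eq_of_eqOn hU (hf (hJ _ hk1)) hz, hf (hJ _ hk1) z hz, hg hk1 z hz] at this
          rw [this, hw]
          simp)
        exact ⟨t, fun _ => ht⟩
      · exact ⟨0, fun h => absurd h hk⟩
    have hw' := (wr_add_C_mul v₀ f t).trans hw
    exact ⟨v₀ + C t * f, ⟨(hgood.of_wr (T.exp_pos _) (T.coeff_ne_zero k) hw').swap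
      (T.exp_mul _), hg, ht⟩, hw'⟩
  · rintro h ⟨hh0, hh1, hh⟩
    exact ⟨h, ⟨hh0, hh1, fun k => (hh k).2⟩, fun k hk => (hh k).1.2.1 hk⟩

/-- An initial segment of a chain of polynomials extends to a complete chain. -/
lemma exists_isChain_eq (T : IsChainType e d) {N : ℕ} {h : ℕ → ℂ[X]} (h0 : h 0 = 1)
    (h1 : h 1 = 1) (hrel : ∀ k, k + 2 ≤ N →
      wr (h (k + 2)) (h k) = C ((d (k + 2) : ℂ) - d k) * h (k + 1) ^ e (k + 1)) :
    ∃ h', IsChain e d h' ∧ ∀ k ≤ N, h' k = h k := by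
  obtain ⟨h', hc, hh⟩ := exists_isChain T isOpen_univ isConnected_univ
    (J := {k | k ≤ N}) (fun k hk => (Nat.le_succ k).trans hk)
    (u := fun k z => (h k).eval z) (fun k _ => (h k).differentiable.differentiableOn)
    (by simp [h0]) (by simp [h1]) (fun k hk z _ => by
      have := congrArg (eval z) (hrel k hk)
      simpa [wr] using this)
  exact ⟨h', hc, fun k hk => (eq_of_eval_eqOn isOpen_univ Set.univ_nonempty (hh k hk)).symm⟩

end Chains

/-! ### Positions, degrees and exponents in the two-sided sequence. -/

/-- The degree of the polynomial at position `j` of `…, p₋₁, q₀, p₀, q₁, p₁, …`. -/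
def posDeg (j : ℤ) : ℕ :=
  if Even j then (j / 2 * (3 * (j / 2) - 1) / 2).toNat else (j / 2 * (3 * (j / 2) + 2)).toNat

/-- The power of the polynomial at position `j` that occurs in the recurrence relation. -/
def posExp (j : ℤ) : ℕ := if Even j then 4 else 1

/-- The arrangement `…, p₋₁, q₀, p₀, q₁, p₁, …` of two sequences. -/
def interleave {α : Type*} (p q : ℤ → α) (j : ℤ) : α := if Even j then q (j / 2) else p (j / 2)

section Positions
variable {α : Type*} (p q : ℤ → α) (i j : ℤ)

lemma not_even_two_mul_add_one : ¬ Even (2 * i + 1) := by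
  rw [Int.not_even_iff_odd]; exact ⟨i, rfl⟩

@[simp] lemma interleave_even : interleave p q (2 * i) = q i := by
  simp [interleave]

@[simp] lemma interleave_odd : interleave p q (2 * i + 1) = p i := by
  rw [interleave, if_neg (not_even_two_mul_add_one i)]; congr 1; lia

@[simp] lemma posExp_even : posExp (2 * i) = 4 := by simp [posExp]

@[simp] lemma posExp_odd : posExp (2 * i + 1) = 1 := by
  rw [posExp, if_neg (not_even_two_mul_add_one i)]

lemma posDeg_even : (posDeg (2 * i) : ℤ) = i * (3 * i - 1) / 2 := by
  have h : 0 ≤ i * (3 * i - 1) := by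
    rcases le_or_gt i 0 with h | h <;> nlinarith
  rw [posDeg, if_pos (even_two_mul i), show 2 * i / 2 = i by lia, Int.toNat_of_nonneg]
  lia

lemma two_mul_posDeg_even : 2 * (posDeg (2 * i) : ℤ) = i * (3 * i - 1) := by
  rw [posDeg_even]
  refine Int.mul_ediv_cancel' ?_
  rcases Int.even_or_odd' i with ⟨k, rfl | rfl⟩
  · exact ⟨k * (3 * (2 * k) - 1), by ring⟩
  · exact ⟨(2 * k + 1) * (3 * k + 1), by ring⟩

lemma posDeg_odd : (posDeg (2 * i + 1) : ℤ) = i * (3 * i + 2) := by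
  have h : 0 ≤ i * (3 * i + 2) := by
    rcases le_or_gt 0 i with h | h <;> nlinarith
  rw [posDeg, if_neg (not_even_two_mul_add_one i), show (2 * i + 1) / 2 = i by lia,
    Int.toNat_of_nonneg h]

lemma posDeg_sub_odd : (posDeg (2 * i + 1 + 1) : ℤ) - posDeg (2 * i + 1 - 1) = 3 * i + 1 := by
  have h1 := two_mul_posDeg_even (i + 1)
  have h2 := two_mul_posDeg_even i
  rw [show 2 * i + 1 + 1 = 2 * (i + 1) by ring, show 2 * i + 1 - 1 = 2 * i by ring]
  linarith

lemma posDeg_sub_even : (posDeg (2 * i + 1) : ℤ) - posDeg (2 * i - 1) = 6 * i - 1 := by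
  have h1 := posDeg_odd (i - 1)
  rw [show 2 * (i - 1) + 1 = 2 * i - 1 by ring] at h1
  rw [h1, posDeg_odd]
  ring

lemma posDeg_add : posDeg (j + 1) + posDeg (j - 1) = posExp j * posDeg j + 1 := by
  zify
  rcases Int.even_or_odd' j with ⟨i, rfl | rfl⟩
  · have h1 := posDeg_odd (i - 1)
    rw [show 2 * (i - 1) + 1 = 2 * i - 1 by ring] at h1
    rw [h1, posDeg_odd, posExp_even]
    have := two_mul_posDeg_even i
    push_cast
    linarith
  · have h1 := two_mul_posDeg_even (i + 1)
    have h2 := two_mul_posDeg_even i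
    rw [show 2 * i + 1 + 1 = 2 * (i + 1) by ring, show 2 * i + 1 - 1 = 2 * i by ring,
      posDeg_odd, posExp_odd]
    push_cast
    linarith

lemma posDeg_lt_of_pos (hj : 1 ≤ j) : posDeg (j - 1) < posDeg (j + 1) := by
  rcases Int.even_or_odd' j with ⟨i, rfl | rfl⟩
  · have := posDeg_sub_even i; lia
  · have := posDeg_sub_odd i; lia

lemma posDeg_lt_of_nonpos (hj : j ≤ 0) : posDeg (j + 1) < posDeg (j - 1) := by
  rcases Int.even_or_odd' j with ⟨i, rfl | rfl⟩
  · have := posDeg_sub_even i; lia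
  · have := posDeg_sub_odd i; lia

lemma posExp_mul : posExp j * posExp (j + 1) = 4 := by
  rcases Int.even_or_odd' j with ⟨i, rfl | rfl⟩
  · simp
  · rw [show 2 * i + 1 + 1 = 2 * (i + 1) by ring]; simp

end Positions

lemma isChainType_up : IsChainType (fun k => posExp k) (fun k => posDeg k) where
  exp_mul k := by simpa using posExp_mul k
  deg_zero := by simp [posDeg]
  deg_one := by simp [posDeg]
  deg_add k := by
    have := posDeg_add (k + 1)
    push_cast
    rwa [show (k : ℤ) + 1 + 1 = k + 2 by ring, show (k : ℤ) + 1 - 1 = k by ring] at this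
  deg_lt k := by
    have := posDeg_lt_of_pos (k + 1) (by lia)
    push_cast
    rwa [show (k : ℤ) + 1 + 1 = k + 2 by ring, show (k : ℤ) + 1 - 1 = k by ring] at this

/-- Positions 1 and 0 carry `p₀ = q₀ = 1`, so the sequence read downwards from position 1 also
begins with `1, 1`, and its degrees grow in the same manner. -/
lemma isChainType_down : IsChainType (fun k => posExp (1 - k)) (fun k => posDeg (1 - k)) where
  exp_mul k := by
    have := posExp_mul (1 - (k + 1 : ℕ))
    rwa [mul_comm, show 1 - ((k + 1 : ℕ) : ℤ) + 1 = 1 - k by push_cast; ring] at this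
  deg_zero := by simp [posDeg]
  deg_one := by simp [posDeg]
  deg_add k := by
    have := posDeg_add (-k)
    rw [show -(k : ℤ) + 1 = 1 - k by ring, show -(k : ℤ) - 1 = 1 - (k + 2 : ℕ) by push_cast; ring,
      show -(k : ℤ) = 1 - (k + 1 : ℕ) by push_cast; ring] at this
    rw [add_comm]; exact this
  deg_lt k := by
    have := posDeg_lt_of_nonpos (-k) (by lia)
    rwa [show -(k : ℤ) + 1 = 1 - k by ring,
      show -(k : ℤ) - 1 = 1 - (k + 2 : ℕ) by push_cast; ring] at this

/-- The recurrence relations in terms of positions. -/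
lemma isPolynomialSolution_iff (P Q : ℤ → ℂ[X]) : IsPolynomialSolution P Q ↔
    P (-1) = X ∧ Q 0 = 1 ∧ P 0 = 1 ∧ Q 1 = X ∧
    ∀ j, wr (interleave P Q (j + 1)) (interleave P Q (j - 1))
      = C ((posDeg (j + 1) : ℂ) - posDeg (j - 1)) * interleave P Q j ^ posExp j := by
  have hodd : ∀ i : ℤ, (posDeg (2 * i + 1 + 1) : ℂ) - posDeg (2 * i + 1 - 1)
      = ((3 * i + 1 : ℤ) : ℂ) := fun i => by exact_mod_cast posDeg_sub_odd i
  have heven : ∀ i : ℤ, (posDeg (2 * i + 1) : ℂ) - posDeg (2 * i - 1)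
      = ((6 * i - 1 : ℤ) : ℂ) := fun i => by exact_mod_cast posDeg_sub_even i
  have e1 : ∀ i : ℤ, interleave P Q (2 * i + 1 + 1) = Q (i + 1) := fun i => by
    rw [show 2 * i + 1 + 1 = 2 * (i + 1) by ring, interleave_even]
  have e2 : ∀ i : ℤ, interleave P Q (2 * i + 1 - 1) = Q i := fun i => by
    rw [show 2 * i + 1 - 1 = 2 * i by ring, interleave_even]
  have e3 : ∀ i : ℤ, interleave P Q (2 * i - 1) = P (i - 1) := fun i => by
    rw [show 2 * i - 1 = 2 * (i - 1) + 1 by ring, interleave_odd]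
  constructor
  · rintro ⟨h1, h2, h3, h4, h5, h6⟩
    refine ⟨h1, h2, h3, h4, fun j => ?_⟩
    rcases Int.even_or_odd' j with ⟨i, rfl | rfl⟩
    · rw [heven, interleave_odd, e3, interleave_even, posExp_even]; exact h6 i
    · rw [hodd, e1, e2, interleave_odd, posExp_odd, pow_one]; exact h5 i
  · rintro ⟨h1, h2, h3, h4, h5⟩
    refine ⟨h1, h2, h3, h4, fun i => ?_, fun i => ?_⟩
    · have := h5 (2 * i + 1)
      rwa [hodd, e1, e2, interleave_odd, posExp_odd, pow_one] at this
    · have := h5 (2 * i)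
      rwa [heven, interleave_odd, e3, interleave_even, posExp_even] at this

/-! ### Polynomial solutions as two glued chains. -/

section Solutions
variable {P Q : ℤ → ℂ[X]}

lemma IsPolynomialSolution.isChain_up (h : IsPolynomialSolution P Q) :
    IsChain (fun k => posExp k) (fun k => posDeg k) (fun k => interleave P Q k) := by
  refine ⟨by simpa [interleave] using h.q_zero, by simpa [interleave] using h.p_zero,
    fun k => ?_⟩
  have := ((isPolynomialSolution_iff P Q).1 h).2.2.2.2 (k + 1)
  push_cast
  rwa [show (k : ℤ) + 1 + 1 = k + 2 by ring, show (k : ℤ) + 1 - 1 = k by ring] at this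

lemma IsPolynomialSolution.isChain_down (h : IsPolynomialSolution P Q) :
    IsChain (fun k => posExp (1 - k)) (fun k => posDeg (1 - k))
      (fun k => interleave P Q (1 - k)) := by
  refine ⟨by simpa [interleave] using h.p_zero, by simpa [interleave] using h.q_zero,
    fun k => ?_⟩
  have := ((isPolynomialSolution_iff P Q).1 h).2.2.2.2 (-k)
  rw [show -(k : ℤ) + 1 = 1 - k by ring, show -(k : ℤ) - 1 = 1 - (k + 2 : ℕ) by push_cast; ring,
    show -(k : ℤ) = 1 - (k + 1 : ℕ) by push_cast; ring] at this
  rw [wr_comm, this, ← neg_mul, ← C_neg, neg_sub]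

lemma interleave_comp {α : Type*} (f : ℤ → α) :
    interleave (fun i => f (2 * i + 1)) (fun i => f (2 * i)) = f := by
  ext j
  rcases Int.even_or_odd' j with ⟨i, rfl | rfl⟩ <;> simp

/-- The two-sided sequence determined by two one-sided chains. -/
noncomputable def glue (h h' : ℕ → ℂ[X]) (j : ℤ) : ℂ[X] :=
  if 0 ≤ j then h j.toNat else h' (1 - j).toNat

lemma glue_natCast (h h' : ℕ → ℂ[X]) (k : ℕ) : glue h h' k = h k := by
  simp [glue]

/-- The two chains overlap at positions 0 and 1, where both equal `1`. -/
lemma glue_one_sub {e d e' d' : ℕ → ℕ} {h h' : ℕ → ℂ[X]} (hc : IsChain e d h)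
    (hc' : IsChain e' d' h') (k : ℕ) : glue h h' (1 - k) = h' k := by
  rcases k with _ | _ | k
  · simp [glue, hc.one, hc'.zero]
  · simp [glue, hc.zero, hc'.one]
  · rw [glue, if_neg (by push_cast; lia)]
    congr 1
    push_cast
    lia

lemma isPolynomialSolution_glue {h h' : ℕ → ℂ[X]}
    (hc : IsChain (fun k => posExp k) (fun k => posDeg k) h)
    (hc' : IsChain (fun k => posExp (1 - k)) (fun k => posDeg (1 - k)) h')
    (h2 : h 2 = X) (h2' : h' 2 = X) :
    IsPolynomialSolution (fun i => glue h h' (2 * i + 1)) (fun i => glue h h' (2 * i)) := by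
  have g1 := glue_natCast h h'
  have g2 := glue_one_sub hc hc'
  rw [isPolynomialSolution_iff, interleave_comp]
  refine ⟨(g2 2).trans h2', (g1 0).trans hc.zero, (g1 1).trans hc.one, (g1 2).trans h2,
    fun j => ?_⟩
  rcases le_or_gt 1 j with hj | hj
  · obtain ⟨k, rfl⟩ : ∃ k : ℕ, j = (k + 1 : ℕ) := ⟨(j - 1).toNat, by lia⟩
    rw [show ((k + 1 : ℕ) : ℤ) + 1 = (k + 2 : ℕ) by push_cast; ring,
      show ((k + 1 : ℕ) : ℤ) - 1 = k by push_cast; ring, g1, g1, g1]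
    exact hc.wr_eq k
  · obtain ⟨k, hk⟩ : ∃ k : ℕ, j = 1 - (k + 1 : ℕ) := ⟨(-j).toNat, by lia⟩
    rw [show j + 1 = 1 - (k : ℕ) by lia, show j - 1 = 1 - (k + 2 : ℕ) by push_cast; lia, hk,
      g2, g2, g2, wr_comm, hc'.wr_eq k, ← neg_mul, ← C_neg, neg_sub]

lemma bracket_two_eq (p q : ℂ[X]) : 4 * bracket 2 p q = ibracket 4 p q := by
  simp only [bracket, ibracket, map_mul, map_pow]
  rw [show (C (2 : ℂ)) = 2 by rfl]
  push_cast
  ring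

lemma bracket_two_eq_zero_iff (p q : ℂ[X]) : bracket 2 p q = 0 ↔ ibracket 4 p q = 0 := by
  rw [← bracket_two_eq]; simp

lemma bracket_two_eq_zero_iff' (p q : ℂ[X]) : bracket 2 p q = 0 ↔ ibracket 1 q p = 0 := by
  rw [bracket_two_eq_zero_iff]
  exact ⟨ibracket_eq_zero_swap rfl, ibracket_eq_zero_swap rfl⟩

/-- Consecutive members of a polynomial solution: degrees and bilinear equations. -/
lemma IsPolynomialSolution.properties (h : IsPolynomialSolution P Q) (j : ℤ) :
    (interleave P Q j).Monic ∧ (interleave P Q j).natDegree = posDeg j ∧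
      ibracket (posExp (j + 1)) (interleave P Q j) (interleave P Q (j + 1)) = 0 := by
  rcases le_or_gt 0 j with hj | hj
  · lift j to ℕ using hj
    have h1 := h.isChain_up.monic_and_natDegree isChainType_up j
    have h2 := h.isChain_up.ibracket_eq_zero isChainType_up j
    exact ⟨h1.1, h1.2, by simpa using h2⟩
  · obtain ⟨k, hk⟩ : ∃ k : ℕ, j = 1 - (k + 1 : ℕ) := ⟨(-j).toNat, by lia⟩
    have h1 := h.isChain_down.monic_and_natDegree isChainType_down (k + 1)
    have h2 := h.isChain_down.ibracket_eq_zero isChainType_down k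
    rw [← hk] at h1 h2
    refine ⟨h1.1, h1.2, ibracket_eq_zero_swap (posExp_mul j) ?_⟩
    rw [show j + 1 = 1 - (k : ℕ) by lia]
    exact h2

lemma IsPolynomialSolution.bracket_eq_zero (h : IsPolynomialSolution P Q) (i : ℤ) :
    bracket 2 (P i) (Q i) = 0 ∧ bracket 2 (P i) (Q (i + 1)) = 0 := by
  constructor
  · rw [bracket_two_eq_zero_iff']
    simpa using (h.properties (2 * i)).2.2
  · rw [bracket_two_eq_zero_iff]
    have := (h.properties (2 * i + 1)).2.2
    rw [show 2 * i + 1 + 1 = 2 * (i + 1) by ring] at this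
    simpa using this

end Solutions

/-! ### Holomorphic solutions, complete or partial. -/

section Holomorphic
variable {U : Set ℂ} {I : Set ℤ} {p q : ℤ → ℂ → ℂ}

lemma IsSolutionOn.differentiableOn (h : IsSolutionOn U I p q) {j : ℤ} (hj : j ∈ I) :
    DifferentiableOn ℂ (interleave p q j) U := by
  rcases Int.even_or_odd' j with ⟨i, rfl | rfl⟩
  · simpa using h.holo_q i hj
  · simpa using h.holo_p i hj

lemma IsSolutionOn.rel (h : IsSolutionOn U I p q) {j : ℤ} (h1 : j - 1 ∈ I) (h2 : j ∈ I)
    (h3 : j + 1 ∈ I) {z : ℂ} (hz : z ∈ U) :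
    deriv (interleave p q (j + 1)) z * interleave p q (j - 1) z
      - interleave p q (j + 1) z * deriv (interleave p q (j - 1)) z
      = ((posDeg (j + 1) : ℂ) - posDeg (j - 1)) * interleave p q j z ^ posExp j := by
  rcases Int.even_or_odd' j with ⟨i, rfl | rfl⟩
  · have hc : (posDeg (2 * i + 1) : ℂ) - posDeg (2 * i - 1) = ((6 * i - 1 : ℤ) : ℂ) := by
      exact_mod_cast posDeg_sub_even i
    have := h.rel_p i h1 h2 h3 z hz
    rw [hc, show 2 * i - 1 = 2 * (i - 1) + 1 by ring]
    simpa using this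
  · have hc : (posDeg (2 * i + 1 + 1) : ℂ) - posDeg (2 * i + 1 - 1) = ((3 * i + 1 : ℤ) : ℂ) := by
      exact_mod_cast posDeg_sub_odd i
    have := h.rel_q i (by convert h1 using 1; ring) h2 (by convert h3 using 1; ring) z hz
    rw [hc, show 2 * i + 1 + 1 = 2 * (i + 1) by ring, show 2 * i + 1 - 1 = 2 * i by ring]
    simpa using this

lemma IsSolutionOn.exists_polynomial (h : IsSolutionOn U I p q) (hU : IsOpen U)
    (hconn : IsConnected U) (hI : I.OrdConnected) (hI2 : Set.Icc (-1) 2 ⊆ I) :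
    ∃ P Q : ℤ → ℂ[X], IsPolynomialSolution P Q ∧
        (∀ i : ℤ, 2 * i + 1 ∈ I → ∀ z ∈ U, p i z = (P i).eval z) ∧
        (∀ i : ℤ, 2 * i ∈ I → ∀ z ∈ U, q i z = (Q i).eval z) := by
  have hm1 : (-1 : ℤ) ∈ I := hI2 ⟨by lia, by lia⟩
  have h0 : (0 : ℤ) ∈ I := hI2 ⟨by lia, by lia⟩
  have h1 : (1 : ℤ) ∈ I := hI2 ⟨by lia, by lia⟩
  have h2 : (2 : ℤ) ∈ I := hI2 ⟨by lia, by lia⟩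
  -- Since `I` is order connected, its parts above 0 and below 1 are initial segments for the upward
  -- and the downward chain.
  obtain ⟨f, hf, hfu⟩ := exists_isChain isChainType_up hU hconn (J := {k | (k : ℤ) ∈ I})
    (u := fun k => interleave p q k)
    (fun k hk => hI.out h0 hk ⟨by lia, by push_cast; lia⟩)
    (fun k hk => h.differentiableOn hk)
    (by simpa [interleave] using h.q_zero) (by simpa [interleave] using h.p_zero)
    (fun k hk z hz => by
      have hk' : (k : ℤ) + 1 + 1 ∈ I := by
        replace hk : ((k + 2 : ℕ) : ℤ) ∈ I := hk
        push_cast at hk; convert hk using 1; ring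
      have := h.rel (j := k + 1) (hI.out h0 hk' ⟨by lia, by lia⟩)
        (hI.out h0 hk' ⟨by lia, by lia⟩) hk' hz
      push_cast
      rwa [show (k : ℤ) + 1 + 1 = k + 2 by ring, show (k : ℤ) + 1 - 1 = k by ring] at this)
  obtain ⟨f', hf', hfu'⟩ := exists_isChain isChainType_down hU hconn
    (J := {k | 1 - (k : ℤ) ∈ I})
    (u := fun k => interleave p q (1 - k))
    (fun k hk => hI.out hk h1 ⟨by push_cast; lia, by lia⟩)
    (fun k hk => h.differentiableOn hk)
    (by simpa [interleave] using h.p_zero) (by simpa [interleave] using h.q_zero)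
    (fun k hk z hz => by
      have hk' : -(k : ℤ) - 1 ∈ I := by
        replace hk : 1 - ((k + 2 : ℕ) : ℤ) ∈ I := hk
        push_cast at hk; convert hk using 1; ring
      have := h.rel (j := -k) hk' (hI.out hk' h1 ⟨by lia, by lia⟩)
        (hI.out hk' h1 ⟨by lia, by lia⟩) hz
      rw [show -(k : ℤ) + 1 = 1 - k by ring,
        show -(k : ℤ) - 1 = 1 - (k + 2 : ℕ) by push_cast; ring,
        show -(k : ℤ) = 1 - (k + 1 : ℕ) by push_cast; ring] at this
      linear_combination -this)
  have hf2 : f 2 = X := eq_of_eval_eqOn hU hconn.nonempty fun z hz => by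
    rw [← hfu 2 h2 z hz, eval_X]; simpa [interleave] using h.q_one z hz
  have hf2' : f' 2 = X := eq_of_eval_eqOn hU hconn.nonempty fun z hz => by
    rw [← hfu' 2 hm1 z hz, eval_X]; simpa [interleave] using h.p_neg_one z hz
  have key : ∀ j ∈ I, ∀ z ∈ U, interleave p q j z = (glue f f' j).eval z := by
    intro j hj z hz
    rcases le_or_gt 0 j with hj0 | hj0
    · lift j to ℕ using hj0
      rw [glue_natCast]; exact hfu j hj z hz
    · obtain ⟨k, rfl⟩ : ∃ k : ℕ, j = 1 - k := ⟨(1 - j).toNat, by lia⟩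
      rw [glue_one_sub hf hf']; exact hfu' k hj z hz
  exact ⟨_, _, isPolynomialSolution_glue hf hf' hf2 hf2',
    fun i hi z hz => by simpa using key _ hi z hz, fun i hi z hz => by simpa using key _ hi z hz⟩

end Holomorphic

/-! ### Descent on degrees and classification of the solutions of the bilinear equation. -/

section Degrees
variable {A : Type*} [CommRing A]

lemma coeff_X_mul_derivative (f : A[X]) (n : ℕ) : (X * derivative f).coeff n = n * f.coeff n := by
  rcases n with _ | n
  · simp
  · rw [coeff_X_mul, coeff_derivative]; push_cast; ring

lemma natDegree_X_mul_derivative_le (f : A[X]) : (X * derivative f).natDegree ≤ f.natDegree :=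
  natDegree_le_iff_coeff_eq_zero.2 fun n hn => by
    rw [coeff_X_mul_derivative, coeff_eq_zero_of_natDegree_lt hn, mul_zero]

/-- The factor `X ^ 2` turns derivatives into the Euler operator `X d/dX`, which multiplies the
coefficient of `X ^ n` by `n`; this avoids truncated degrees. -/
lemma coeff_X_sq_mul_ibracket (e : ℕ) (f g : A[X]) :
    (X ^ 2 * ibracket e f g).coeff (f.natDegree + g.natDegree)
      = (4 * (f.natDegree * (f.natDegree - 1)) - 4 * (e : A) * (f.natDegree * g.natDegree)
        + (e : A) ^ 2 * (g.natDegree * (g.natDegree - 1))) * (f.leadingCoeff * g.leadingCoeff) := by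
  set θ : A[X] → A[X] := fun u => X * derivative u with hθ
  have hle : ∀ u, (θ u).natDegree ≤ u.natDegree := natDegree_X_mul_derivative_le
  have hle2 : ∀ u, (θ (θ u)).natDegree ≤ u.natDegree := fun u => (hle _).trans (hle _)
  have hco : ∀ u n, (θ u).coeff n = n * u.coeff n := coeff_X_mul_derivative
  have hcoe : ∀ (k : ℕ) (u : A[X]) n, ((k : A[X]) * u).coeff n = k * u.coeff n := by
    intro k u n; rw [← C_eq_natCast, coeff_C_mul]
  have hsmul : X ^ 2 * ibracket e f g = ((4 : ℕ) : A[X]) * (θ (θ f) * g - θ f * g)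
      - (((4 * e : ℕ) : A[X]) * (θ f * θ g))
      + ((e ^ 2 : ℕ) : A[X]) * (f * θ (θ g) - f * θ g) := by
    simp only [hθ, ibracket, derivative_mul, derivative_X]; push_cast; ring
  have hf := le_refl f.natDegree
  have hg := le_refl g.natDegree
  rw [hsmul, coeff_add, coeff_sub, hcoe, hcoe, hcoe, coeff_sub, coeff_sub,
    coeff_mul_add_eq_of_natDegree_le (hle2 f) hg, coeff_mul_add_eq_of_natDegree_le (hle f) hg,
    coeff_mul_add_eq_of_natDegree_le (hle f) (hle g),
    coeff_mul_add_eq_of_natDegree_le hf (hle2 g), coeff_mul_add_eq_of_natDegree_le hf (hle g)]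
  simp only [hco, coeff_natDegree]
  push_cast
  ring

end Degrees

/-- Solutions of the bilinear equation are constant, or one of the two degrees can be
lowered. -/
lemma natDegree_trichotomy {e e' : ℕ} (he : (e = 1 ∧ e' = 4) ∨ (e = 4 ∧ e' = 1)) {f g : ℂ[X]}
    (hf : f ≠ 0) (hg : g ≠ 0) (h : ibracket e f g = 0) :
    f.natDegree + g.natDegree = 0 ∨ e * g.natDegree + 1 < 2 * f.natDegree ∨
      e' * f.natDegree + 1 < 2 * g.natDegree := by
  have h1 := coeff_X_sq_mul_ibracket e f g
  rw [h, mul_zero, coeff_zero, eq_comm, mul_eq_zero, or_iff_left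
    (mul_ne_zero (leadingCoeff_ne_zero.2 hf) (leadingCoeff_ne_zero.2 hg))] at h1
  set a := f.natDegree
  set b := g.natDegree
  have h2 : (4 * (a * (a - 1)) - 4 * e * (a * b) + e ^ 2 * (b * (b - 1)) : ℤ) = 0 := by
    exact_mod_cast h1
  rcases he with ⟨rfl, rfl⟩ | ⟨rfl, rfl⟩
  · have h3 : ((b : ℤ) - 2 * a) ^ 2 = b + 4 * a := by push_cast at h2; linarith
    rcases lt_trichotomy ((b : ℤ) - 2 * a) 0 with hk | hk | hk
    · rcases eq_or_lt_of_le (show (b : ℤ) - 2 * a ≤ -1 by lia) with hk' | hk'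
      · rw [hk'] at h3; lia
      · right; left; lia
    · rw [hk] at h3; left; lia
    · right; right; lia
  · have h3 : ((a : ℤ) - 2 * b) ^ 2 = a + 4 * b := by push_cast at h2; linarith
    rcases lt_trichotomy ((a : ℤ) - 2 * b) 0 with hk | hk | hk
    · rcases eq_or_lt_of_le (show (a : ℤ) - 2 * b ≤ -1 by lia) with hk' | hk'
      · rw [hk'] at h3; lia
      · right; right; lia
    · rw [hk] at h3; left; lia
    · right; left; lia

/-- Among the solutions of a Wronskian equation there is one whose degree differs from that of
the given solution. -/
lemma exists_wr_eq_natDegree_ne {K : Type*} [Field K] {g r u : K[X]} (hr : r ≠ 0) (hg : g ≠ 0)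
    (h : wr u g = r) : ∃ v, wr v g = r ∧ v.natDegree ≠ g.natDegree := by
  by_cases hd : u.natDegree = g.natDegree
  · have hu : u ≠ 0 := by rintro rfl; simp [wr] at h; exact hr h.symm
    have hu' := leadingCoeff_ne_zero.2 hu
    have hg' := leadingCoeff_ne_zero.2 hg
    set t := u.leadingCoeff / g.leadingCoeff with ht
    have ht0 : t ≠ 0 := div_ne_zero hu' hg'
    have hv : u + C (-t) * g = u - C t * g := by rw [C_neg]; ring
    have hw : wr (u - C t * g) g = r := by rw [← hv, wr_add_C_mul, h]
    refine ⟨_, hw, ?_⟩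
    have hne : u - C t * g ≠ 0 := by
      intro h0
      rw [h0] at hw
      simp [wr] at hw
      exact hr hw.symm
    have hlt : (u - C t * g).degree < u.degree := by
      apply degree_sub_lt_left _ hu
      · rw [leadingCoeff_mul, leadingCoeff_C, ht]; field_simp
      · rw [degree_C_mul ht0, degree_eq_natDegree hu, degree_eq_natDegree hg, hd]
    have := natDegree_lt_natDegree hne hlt
    lia
  · exact ⟨u, h, hd⟩

/-- The two types of one-sided chains that make up the solutions of the recurrences. -/
def IsOneSided (E D : ℕ → ℕ) : Prop :=
  (E = (fun k : ℕ => posExp k) ∧ D = fun k : ℕ => posDeg k) ∨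
    (E = (fun k : ℕ => posExp (1 - k)) ∧ D = fun k : ℕ => posDeg (1 - k))

lemma IsOneSided.isChainType {E D : ℕ → ℕ} (h : IsOneSided E D) : IsChainType E D := by
  rcases h with ⟨rfl, rfl⟩ | ⟨rfl, rfl⟩
  · exact isChainType_up
  · exact isChainType_down

lemma exists_isChain_of_type {E D : ℕ → ℕ} (T : IsChainType E D) :
    ∃ h, IsChain E D h ∧ h 2 = X := by
  obtain ⟨h, hc, hh⟩ := exists_isChain_eq T (N := 2) (h := fun k => if k ≤ 1 then 1 else X)
    (by simp) (by simp) (fun k hk => by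
      obtain rfl : k = 0 := by lia
      have h2 : D 2 = 1 := by
        have := T.deg_add 0
        simpa [T.deg_zero, T.deg_one] using this
      simp [wr, h2, T.deg_zero])
  exact ⟨h, hc, by simpa using hh 2 le_rfl⟩

/-- Lowering degrees leads from a pair of polynomials to the beginning of a chain. -/
lemma IsGood.exists_isChain {e e' : ℕ} (he : (e = 1 ∧ e' = 4) ∨ (e = 4 ∧ e' = 1)) {f g : ℂ[X]}
    (h : IsGood e f g) (hd : f.natDegree + g.natDegree = 0 ∨
      e' * f.natDegree + 1 < 2 * g.natDegree) :
    ∃ (E D : ℕ → ℕ) (c : ℕ → ℂ[X]) (N : ℕ) (α β : ℂ), IsOneSided E D ∧ IsChain E D c ∧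
      E (N + 1) = e ∧ α ≠ 0 ∧ β ≠ 0 ∧ f = C α * c N ∧ g = C β * c (N + 1) := by
  induction hn : f.natDegree + g.natDegree using Nat.strong_induction_on
    generalizing e e' f g with
  | _ n ih =>
  by_cases hn0 : n = 0
  · have hf := eq_C_of_natDegree_eq_zero (show f.natDegree = 0 by lia)
    have hg := eq_C_of_natDegree_eq_zero (show g.natDegree = 0 by lia)
    have hα : f.coeff 0 ≠ 0 := fun h0 => h.1 (by rw [hf, h0, C_0])
    have hβ : g.coeff 0 ≠ 0 := fun h0 => h.2.1 (by rw [hg, h0, C_0])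
    obtain ⟨E, D, hED, hE⟩ : ∃ E D, IsOneSided E D ∧ E 1 = e := by
      rcases he with ⟨rfl, -⟩ | ⟨rfl, -⟩
      · exact ⟨_, _, Or.inl ⟨rfl, rfl⟩, by simp [posExp]⟩
      · exact ⟨_, _, Or.inr ⟨rfl, rfl⟩, by simp [posExp]⟩
    obtain ⟨c, hc, -⟩ := exists_isChain_of_type hED.isChainType
    exact ⟨E, D, c, 0, _, _, hED, hc, hE, hα, hβ, by simpa [hc.zero] using hf,
      by simpa [hc.one] using hg⟩
  · replace hd := hd.resolve_left (by lia)
    have he1 : e * e' = 4 := by rcases he with ⟨rfl, rfl⟩ | ⟨rfl, rfl⟩ <;> rfl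
    have he' : 1 ≤ e' := by rcases he with ⟨rfl, rfl⟩ | ⟨rfl, rfl⟩ <;> simp
    have hs := h.swap he1
    -- Run the recurrence backwards: `g` is exchanged for a second solution `v` of the equation
    -- given `f`, so that `(v, f)` precedes `(f, g)`.
    obtain ⟨v₀, hv₀⟩ := hs.exists_wr_eq he'
    obtain ⟨v, hv, hvd⟩ := exists_wr_eq_natDegree_ne (pow_ne_zero _ h.1) h.2.1 hv₀
    have hgv : IsGood e' v f := hs.of_wr he' one_ne_zero (by rw [hv, C_1, one_mul])
    have hdeg : v.natDegree + g.natDegree = e' * f.natDegree + 1 := by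
      have h1 := coeff_wr (le_refl v.natDegree) (le_refl g.natDegree)
      have h2 := natDegree_wr_le v g
      have h3 : (v.natDegree - g.natDegree : ℂ) ≠ 0 := sub_ne_zero.2 (by exact_mod_cast hvd)
      have h4 := le_natDegree_of_ne_zero (h1.trans_ne (mul_ne_zero h3
        (mul_ne_zero (leadingCoeff_ne_zero.2 hgv.1) (leadingCoeff_ne_zero.2 h.2.1))))
      rw [hv, natDegree_pow] at h2 h4
      lia
    -- The degree relation and `hd` give `deg v < deg g`, so the total degree drops; they also
    -- exclude the middle case of the trichotomy for `(v, f)`.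
    obtain ⟨E, D, c, N, α, β, hED, hc, hE, hα, hβ, hvc, hfc⟩ :=
      ih (v.natDegree + f.natDegree) (by lia) (e := e') (e' := e)
        (by rcases he with he | he <;> simp [he]) hgv (by
          rcases natDegree_trichotomy (e := e') (e' := e) (by rcases he with he | he <;> simp [he])
            hgv.1 hgv.2.1 hgv.ibracket_eq_zero with h1 | h1 | h1
          · exact Or.inl h1
          · lia
          · exact Or.inr h1) rfl
    have hT := hED.isChainType
    -- The factor that makes `κ g` satisfy the normalized recurrence after `c N`, `c (N + 1)`; the
    -- sign comes from reversing the Wronskian.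
    set κ : ℂ := -((D (N + 2) - D N) * α / β ^ e') with hκ
    have hκ0 : κ ≠ 0 := neg_ne_zero.2 (div_ne_zero (mul_ne_zero (hT.coeff_ne_zero N) hα)
      (pow_ne_zero _ hβ))
    have hw : wr (C κ * g) (c N) = C ((D (N + 2) : ℂ) - D N) * c (N + 1) ^ E (N + 1) := by
      have h1 : C α * wr g (c N) = - (C (β ^ e') * c (N + 1) ^ e') := by
        rw [← wr_C_mul_right, ← hvc, wr_comm, hv, hfc, mul_pow, C_pow]
      have h2 : wr g (c N) = C (α⁻¹) * - (C (β ^ e') * c (N + 1) ^ e') := by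
        rw [← h1, ← mul_assoc, ← C_mul, inv_mul_cancel₀ hα, C_1, one_mul]
      rw [wr_C_mul_left, h2, hE, mul_neg, ← mul_assoc (C α⁻¹), ← C_mul, ← neg_mul, ← C_neg,
        ← mul_assoc, ← C_mul]
      congr 2
      rw [hκ]
      have := pow_ne_zero e' hβ
      field_simp
    obtain ⟨c', hc', hcc⟩ := exists_isChain_eq hT (N := N + 2)
      (h := fun k => if k ≤ N + 1 then c k else C κ * g) (by simp [hc.zero]) (by simp [hc.one])
      (fun k hk => by
        rcases Nat.lt_or_ge k N with hkN | hkN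
        · simp only [show k + 2 ≤ N + 1 by lia, show k ≤ N + 1 by lia,
            show k + 1 ≤ N + 1 by lia, if_true]
          exact hc.wr_eq k
        · obtain rfl : k = N := by lia
          simpa using hw)
    refine ⟨E, D, c', N + 1, β, κ⁻¹, hED, hc', ?_, hβ, inv_ne_zero hκ0, ?_, ?_⟩
    · have := hT.exp_mul (N + 1)
      rw [hE, ← he1, mul_comm] at this
      exact Nat.eq_of_mul_eq_mul_right he' this
    · rw [hcc (N + 1) (by lia)]; simpa using hfc
    · rw [hcc (N + 2) le_rfl]
      simp only [show ¬ (N + 2 ≤ N + 1) by lia, if_false]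
      rw [← mul_assoc, ← C_mul, inv_mul_cancel₀ hκ0, C_1, one_mul]

lemma IsChain.comp {E D : ℕ → ℕ} {h : ℕ → ℂ[X]} (hc : IsChain E D h) (t : ℂ) :
    IsChain E D (fun k => (h k).comp (X + C t)) :=
  ⟨by simp [hc.zero], by simp [hc.one], fun k => by
    rw [wr_comp_X_add_C, hc.wr_eq]; simp⟩

/-- A pair of consecutive members of a chain belongs, up to translation, to a polynomial solution
of the recurrences. -/
lemma exists_isPolynomialSolution {E D : ℕ → ℕ} {h : ℕ → ℂ[X]} (hED : IsOneSided E D)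
    (hc : IsChain E D h) (N : ℕ) :
    ∃ (P Q : ℤ → ℂ[X]) (j j' : ℤ) (t : ℂ), IsPolynomialSolution P Q ∧ (j' = j + 1 ∨ j = j' + 1) ∧
      posExp j' = E (N + 1) ∧ h N = (interleave P Q j).comp (X + C t) ∧
      h (N + 1) = (interleave P Q j').comp (X + C t) := by
  obtain ⟨t, ht⟩ : ∃ t, h 2 = X + C t := by
    have h1 := hc.monic_and_natDegree hED.isChainType 2
    refine ⟨_, h1.1.eq_X_add_C ?_⟩
    have := hED.isChainType.deg_add 0
    rw [h1.2]
    simpa [hED.isChainType.deg_zero, hED.isChainType.deg_one] using this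
  have hc' := hc.comp (-t)
  have h2 : (h 2).comp (X + C (-t)) = X := by rw [ht]; simp
  have hback : ∀ k, h k = ((h k).comp (X + C (-t))).comp (X + C t) := by
    intro k; rw [comp_assoc]; simp
  rcases hED with ⟨rfl, rfl⟩ | ⟨rfl, rfl⟩
  -- The given pair fixes nothing on the other side of the sequence, so any chain whose linear
  -- member is `X` completes it.
  · obtain ⟨k, hk, hk2⟩ := exists_isChain_of_type isChainType_down
    refine ⟨_, _, N, N + 1, t, isPolynomialSolution_glue hc' hk h2 hk2, Or.inl rfl,
      by push_cast; rfl, ?_, ?_⟩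
    · rw [interleave_comp, glue_natCast]; exact hback N
    · rw [interleave_comp, show (N : ℤ) + 1 = (N + 1 : ℕ) by push_cast; rfl, glue_natCast]
      exact hback (N + 1)
  · obtain ⟨k, hk, hk2⟩ := exists_isChain_of_type isChainType_up
    refine ⟨_, _, 1 - N, 1 - (N + 1 : ℕ), t, isPolynomialSolution_glue hk hc' hk2 h2,
      Or.inr (by push_cast; ring), rfl, ?_, ?_⟩
    · rw [interleave_comp, glue_one_sub hk hc']; exact hback N
    · rw [interleave_comp, glue_one_sub hk hc']; exact hback (N + 1)

lemma isRecurrencePair_of_bracket {p q : ℂ[X]} (hp : p.Separable) (hq : q.Separable)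
    (hpq : IsCoprime p q) (h : bracket 2 p q = 0) : IsRecurrencePair p q := by
  have hgood := isGood_of_separable hp hq hpq ((bracket_two_eq_zero_iff p q).1 h)
  have aux : p.natDegree + q.natDegree = 0 ∨ 1 * p.natDegree + 1 < 2 * q.natDegree →
      IsRecurrencePair p q := by
    intro hd
    obtain ⟨E, D, c, N, α, β, hED, hc, hE, hα, hβ, hf, hg⟩ :=
      hgood.exists_isChain (e' := 1) (by simp) hd
    obtain ⟨P, Q, j, j', t, hPQ, hjj, hj, hcN, hcN'⟩ := exists_isPolynomialSolution hED hc N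
    rw [hE] at hj
    -- Exponent 4 occurs only at even positions, so `q` is one of the `Q i`.
    rcases Int.even_or_odd' j' with ⟨i, rfl | rfl⟩
    swap
    · simp at hj
    rw [interleave_even] at hcN'
    rcases hjj with hjj | rfl
    · obtain rfl : j = 2 * (i - 1) + 1 := by lia
      rw [interleave_odd] at hcN
      exact ⟨P, Q, i - 1, α, β, t, hPQ, hα, hβ, by rw [hf, hcN],
        Or.inr (by rw [hg, hcN', sub_add_cancel])⟩
    · rw [interleave_odd] at hcN
      exact ⟨P, Q, i, α, β, t, hPQ, hα, hβ, by rw [hf, hcN], Or.inl (by rw [hg, hcN'])⟩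
  rcases natDegree_trichotomy (e := 4) (e' := 1) (by simp) hgood.1 hgood.2.1
    hgood.ibracket_eq_zero with hd | hd | hd
  · exact aux (Or.inl hd)
  · obtain ⟨E, D, c, N, α, β, hED, hc, hE, hα, hβ, hf, hg⟩ :=
      (hgood.swap (e' := 1) rfl).exists_isChain (e' := 4) (by simp) (Or.inr hd)
    obtain ⟨P, Q, j, j', t, hPQ, hjj, hj, hcN, hcN'⟩ := exists_isPolynomialSolution hED hc N
    rw [hE] at hj
    rcases Int.even_or_odd' j' with ⟨i, rfl | rfl⟩
    · simp at hj
    rw [interleave_odd] at hcN'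
    rcases hjj with hjj | rfl
    · obtain rfl : j = 2 * i := by lia
      rw [interleave_even] at hcN
      exact ⟨P, Q, i, β, α, t, hPQ, hβ, hα, by rw [hg, hcN'], Or.inl (by rw [hf, hcN])⟩
    · rw [show 2 * i + 1 + 1 = 2 * (i + 1) by ring, interleave_even] at hcN
      exact ⟨P, Q, i, β, α, t, hPQ, hβ, hα, by rw [hg, hcN'], Or.inr (by rw [hf, hcN])⟩
  · exact aux (Or.inr hd)

lemma ibracket_comp_X_add_C {A : Type*} [CommRing A] (e : ℕ) (f g : A[X]) (t : A) :
    ibracket e (f.comp (X + C t)) (g.comp (X + C t)) = (ibracket e f g).comp (X + C t) := by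
  simp [ibracket, derivative_comp]

lemma bracket_of_isRecurrencePair {p q : ℂ[X]} (h : IsRecurrencePair p q) :
    bracket 2 p q = 0 := by
  obtain ⟨P, Q, i, a, b, c, hPQ, -, -, rfl, rfl | rfl⟩ := h
  · rw [bracket_two_eq_zero_iff, ibracket_C_mul, ibracket_comp_X_add_C,
      (bracket_two_eq_zero_iff _ _).1 (hPQ.bracket_eq_zero i).1]
    simp
  · rw [bracket_two_eq_zero_iff, ibracket_C_mul, ibracket_comp_X_add_C,
      (bracket_two_eq_zero_iff _ _).1 (hPQ.bracket_eq_zero i).2]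
    simp

/-! ### The bilinear equation as a condition at the roots. -/

lemma dvd_of_forall_isRoot {p r : ℂ[X]} (hp : p.Separable)
    (h : ∀ x, p.eval x = 0 → r.eval x = 0) : p ∣ r := by
  by_cases hr : r = 0
  · simp [hr]
  rw [IsAlgClosed.dvd_iff_roots_le_roots hp.ne_zero hr, Multiset.le_iff_subset (nodup_roots hp)]
  intro x hx
  exact (mem_roots hr).2 (h x (mem_roots'.1 hx).2)

/-- The bilinear equation holds as soon as it holds at the roots of the two polynomials. -/
lemma bracket_two_eq_zero_iff_eval {p q : ℂ[X]} (hp : p.Separable) (hq : q.Separable)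
    (hpq : IsCoprime p q) : bracket 2 p q = 0 ↔
      (∀ x, p.eval x = 0 →
        (q * derivative (derivative p) - 4 * (derivative p * derivative q)).eval x = 0) ∧
      (∀ y, q.eval y = 0 →
        (derivative p * derivative q - p * derivative (derivative q)).eval y = 0) := by
  have hB : bracket 2 p q = derivative (derivative p) * q
      - C 4 * (derivative p * derivative q) + C 4 * (p * derivative (derivative q)) := by
    rw [bracket]; norm_num
  constructor
  · intro h
    rw [hB] at h
    refine ⟨fun x hx => ?_, fun y hy => ?_⟩
    · have := congrArg (eval x) h
      simp only [eval_add, eval_sub, eval_mul, eval_C, eval_ofNat, eval_zero, hx] at this ⊢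
      linear_combination this
    · have := congrArg (eval y) h
      simp only [eval_add, eval_sub, eval_mul, eval_C, eval_zero, hy] at this ⊢
      linear_combination (-1 / 4 : ℂ) * this
  · rintro ⟨h1, h2⟩
    have hdvd : p * q ∣ bracket 2 p q := by
      refine hpq.mul_dvd (dvd_of_forall_isRoot hp fun x hx => ?_)
        (dvd_of_forall_isRoot hq fun y hy => ?_)
      · have := h1 x hx
        rw [hB]
        simp only [eval_add, eval_sub, eval_mul, eval_C, eval_ofNat, hx] at this ⊢
        linear_combination this
      · have := h2 y hy
        rw [hB]
        simp only [eval_add, eval_sub, eval_mul, eval_C, hy] at this ⊢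
        linear_combination -4 * this
    have hq0 : q.degree ≠ ⊥ := fun h => hq.ne_zero (degree_eq_bot.1 h)
    have hp0 : p.degree ≠ ⊥ := fun h => hp.ne_zero (degree_eq_bot.1 h)
    have d1 : (derivative (derivative p) * q).degree < (p * q).degree := by
      rw [degree_mul, degree_mul]
      exact WithBot.add_lt_add_right hq0
        (degree_derivative_le.trans_lt (degree_derivative_lt hp.ne_zero))
    have d2 : (derivative p * derivative q).degree < (p * q).degree := by
      rw [degree_mul, degree_mul]
      exact (add_le_add_right degree_derivative_le _).trans_lt
        (WithBot.add_lt_add_right hq0 (degree_derivative_lt hp.ne_zero))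
    have d3 : (p * derivative (derivative q)).degree < (p * q).degree := by
      rw [degree_mul, degree_mul]
      exact WithBot.add_lt_add_left hp0
        (degree_derivative_le.trans_lt (degree_derivative_lt hq.ne_zero))
    refine eq_zero_of_dvd_of_degree_lt hdvd ?_
    rw [hB]
    refine (degree_add_le _ _).trans_lt (max_lt ((degree_sub_le _ _).trans_lt (max_lt d1 ?_)) ?_)
    · rwa [degree_C_mul (by norm_num)]
    · rwa [degree_C_mul (by norm_num)]

/-! ### Rational integrals and vanishing residues. -/

lemma hasDerivAt_div {a b : ℂ[X]} {z : ℂ} (hz : b.eval z ≠ 0) :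
    HasDerivAt (fun w : ℂ => a.eval w / b.eval w) ((wr a b).eval z / b.eval z ^ 2) z := by
  refine ((a.hasDerivAt z).div (b.hasDerivAt z) hz).congr_deriv ?_
  simp [wr]

/-- The derivative formula holds off the zeros of `b` and `g`. Multiplied by `b * g` it holds
everywhere, hence as an identity of polynomials. -/
lemma hasRationalIntegral_iff {f g : ℂ[X]} (hg : g ≠ 0) :
    HasRationalIntegral f g ↔ ∃ a b : ℂ[X], b ≠ 0 ∧ wr a b * g = f * b ^ 2 := by
  constructor
  · rintro ⟨a, b, hb, h⟩
    refine ⟨a, b, hb, ?_⟩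
    have h0 : b * g * (wr a b * g - f * b ^ 2) = 0 := by
      refine funext fun z => ?_
      simp only [eval_mul, eval_sub, eval_pow, eval_zero]
      by_cases hbz : b.eval z = 0
      · simp [hbz]
      by_cases hgz : g.eval z = 0
      · simp [hgz]
      have h1 := (hasDerivAt_div (a := a) hbz).unique (h z hbz hgz)
      rw [div_eq_div_iff (pow_ne_zero _ hbz) hgz] at h1
      rw [h1, sub_self, mul_zero]
    exact sub_eq_zero.1 ((mul_eq_zero.1 h0).resolve_left (mul_ne_zero hb hg))
  · rintro ⟨a, b, hb, h⟩
    refine ⟨a, b, hb, fun z hbz hgz => (hasDerivAt_div hbz).congr_deriv ?_⟩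
    rw [div_eq_div_iff (pow_ne_zero _ hbz) hgz, ← eval_mul, h, eval_mul, eval_pow]

lemma exists_isCoprime_wr {f g a b : ℂ[X]} (hb : b ≠ 0) (h : wr a b * g = f * b ^ 2) :
    ∃ a' b' : ℂ[X], b' ≠ 0 ∧ IsCoprime a' b' ∧ wr a' b' * g = f * b' ^ 2 := by
  obtain ⟨a', ha'⟩ := EuclideanDomain.gcd_dvd_left a b
  obtain ⟨b', hb'⟩ := EuclideanDomain.gcd_dvd_right a b
  have hbez := EuclideanDomain.gcd_eq_gcd_ab a b
  generalize EuclideanDomain.gcdA a b = u at hbez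
  generalize EuclideanDomain.gcdB a b = v at hbez
  generalize EuclideanDomain.gcd a b = c at ha' hb' hbez
  have hc : c ≠ 0 := by rintro h0; rw [h0, zero_mul] at hb'; exact hb hb'
  refine ⟨a', b', ?_, ⟨u, v, ?_⟩, ?_⟩
  · rintro rfl; rw [mul_zero] at hb'; exact hb hb'
  · apply mul_left_cancel₀ hc
    linear_combination -hbez - u * ha' - v * hb'
  · apply mul_left_cancel₀ (pow_ne_zero 2 hc)
    have h1 : wr a b = c ^ 2 * wr a' b' := by
      rw [ha', hb']
      simp only [wr, derivative_mul]; ring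
    rw [h1] at h
    rw [← mul_assoc, h, hb']; ring

/-- If `f / g²` has a rational antiderivative, then its residues at the zeros of `g` vanish. -/
lemma eval_eq_zero_of_wr {f g a b : ℂ[X]} (hg : g.Separable) (hfg : IsCoprime f g) (hb : b ≠ 0)
    (h : wr a b * g ^ 2 = f * b ^ 2) {y : ℂ} (hy : g.eval y = 0) :
    (derivative f * derivative g - f * derivative (derivative g)).eval y = 0 := by
  obtain ⟨a, b, hb, hab, h⟩ := exists_isCoprime_wr hb h
  have hfy : f.eval y ≠ 0 := by
    intro h0
    obtain ⟨u, v, huv⟩ := hfg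
    have := congrArg (eval y) huv
    simp [h0, hy] at this
  obtain ⟨g₁, hg₁⟩ := dvd_iff_isRoot.2 hy
  have hg₁y : g₁.eval y ≠ 0 := by
    intro h0
    obtain ⟨u, v, huv⟩ := hg
    have h1 := congrArg (eval y) huv
    rw [hg₁] at h1
    simp [h0] at h1
  obtain ⟨b₁, hb₁, hndvd⟩ := exists_eq_pow_rootMultiplicity_mul_and_not_dvd b hb y
  set m := rootMultiplicity y b
  have hb₁y : b₁.eval y ≠ 0 := fun h0 => hndvd (dvd_iff_isRoot.2 h0)
  have hX : (X - C y : ℂ[X]) ≠ 0 := X_sub_C_ne_zero y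
  -- Here `m` is the pole order at `y` of the reduced fraction `a / b`, whose derivative has a
  -- double pole. Orders `0` and at least `2` are contradictory; for order `1`, `key` and its
  -- derivative at `y` give the residue condition.
  rcases hm : m with _ | m'
  · exfalso
    rw [hm, pow_zero, one_mul] at hb₁
    have := congrArg (eval y) h
    rw [hb₁] at this
    simp only [eval_mul, eval_pow, hy] at this
    exact mul_ne_zero hfy (pow_ne_zero 2 hb₁y) (by rw [← this]; ring)
  · have hay : a.eval y ≠ 0 := by
      intro h0
      obtain ⟨u, v, huv⟩ := hab
      have := congrArg (eval y) huv
      rw [hb₁, hm] at this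
      simp [h0] at this
    rw [hm] at hb₁
    have key : ((X - C y) * wr a b₁ - ((m' : ℂ[X]) + 1) * (a * b₁)) * g₁ ^ 2
        = f * (X - C y) ^ m' * b₁ ^ 2 := by
      apply mul_left_cancel₀ (pow_ne_zero (m' + 2) hX)
      have h1 : wr a b = (X - C y) ^ m' * ((X - C y) * wr a b₁ - ((m' : ℂ[X]) + 1) * (a * b₁)) := by
        rw [hb₁]
        simp only [wr, derivative_mul, derivative_X_sub_C_pow, Nat.add_sub_cancel]
        push_cast
        simp only [map_add, map_natCast, map_one]
        ring
      rw [h1, hg₁, hb₁] at h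
      linear_combination h
    rcases m' with _ | m'
    · simp only [Nat.cast_zero, zero_add, one_mul, pow_zero, mul_one] at key
      have k1 := congrArg (eval y) key
      have k2 := congrArg (eval y) (congrArg derivative key)
      simp only [wr, derivative_mul, derivative_sub, derivative_X, derivative_C, derivative_pow,
        eval_mul, eval_sub, eval_add, eval_pow, eval_X, eval_C, sub_self, zero_mul,
        sub_zero, Nat.cast_ofNat, one_mul, zero_sub, map_ofNat, eval_ofNat,
        Nat.add_one_sub_one, pow_one] at k1 k2
      rw [hg₁]
      simp only [derivative_mul, derivative_sub, derivative_X, derivative_C, eval_mul, eval_sub,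
        eval_add, eval_X, eval_C, sub_self, zero_mul, sub_zero, one_mul, derivative_add, add_zero]
      have hbb := pow_ne_zero 2 hb₁y
      apply mul_left_cancel₀ hbb
      have k3 : -(a.eval y * g₁.eval y ^ 2) = f.eval y * b₁.eval y := by
        apply mul_left_cancel₀ hb₁y
        linear_combination k1
      linear_combination -g₁.eval y * k2
        + (2 * (derivative b₁).eval y * g₁.eval y + 2 * b₁.eval y * (derivative g₁).eval y) * k3
    · exfalso
      have := congrArg (eval y) key
      simp [hay, hb₁y, hg₁y] at this
      exact absurd this (by exact_mod_cast Nat.succ_ne_zero (m' + 1))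

/-- For separable `g` coprime to `f`, the function `f / g²` has a rational antiderivative if and
only if its residues at the zeros of `g` vanish. -/
lemma hasRationalIntegral_sq_iff {f g : ℂ[X]} (hg : g.Separable) (hfg : IsCoprime f g) :
    HasRationalIntegral f (g ^ 2) ↔ ∀ y, g.eval y = 0 →
      (derivative f * derivative g - f * derivative (derivative g)).eval y = 0 := by
  rw [hasRationalIntegral_iff (pow_ne_zero 2 hg.ne_zero)]
  constructor
  · rintro ⟨a, b, hb, h⟩ y hy
    exact eval_eq_zero_of_wr hg hfg hb h hy
  · intro h
    obtain ⟨a, ha⟩ := exists_wr_eq hg (dvd_of_forall_isRoot hg h)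
    exact ⟨a, g, hg.ne_zero, by rw [ha]⟩

lemma eval_ne_zero_of_isCoprime {p q : ℂ[X]} (h : IsCoprime p q) {x : ℂ} (hx : p.eval x = 0) :
    q.eval x ≠ 0 := by
  intro h0
  obtain ⟨u, v, huv⟩ := h
  have := congrArg (eval x) huv
  simp [h0, hx] at this

/-- The first integral accounts for the roots of `q`. The second accounts for those of `p`, where
the residue condition contains the nonzero factor `q ^ 3`. -/
lemma bracket_two_eq_zero_iff_hasRationalIntegral {p q : ℂ[X]} (hp : p.Separable)
    (hq : q.Separable) (hpq : IsCoprime p q) : bracket 2 p q = 0 ↔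
      HasRationalIntegral p (q ^ 2) ∧ HasRationalIntegral (q ^ 4) (p ^ 2) := by
  rw [bracket_two_eq_zero_iff_eval hp hq hpq, hasRationalIntegral_sq_iff hq hpq,
    hasRationalIntegral_sq_iff hp hpq.symm.pow_left, and_comm]
  refine and_congr_right fun _ => forall₂_congr fun x hx => ?_
  have hqx := eval_ne_zero_of_isCoprime hpq hx
  have h : derivative (q ^ 4) * derivative p - q ^ 4 * derivative (derivative p)
      = -(q ^ 3 * (q * derivative (derivative p) - 4 * (derivative p * derivative q))) := by
    simp only [derivative_pow]
    push_cast
    simp only [map_ofNat]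
    ring
  rw [h, eval_neg, neg_eq_zero, eval_mul, eval_pow, mul_eq_zero, or_iff_right (pow_ne_zero 3 hqx)]

/-! ### The energy and its critical points. -/

lemma hasFDerivAt_log_norm {w : ℂ} (hw : w ≠ 0) :
    HasFDerivAt (𝕜 := ℝ) (fun w : ℂ => Real.log ‖w‖)
      (Complex.reCLM.comp (w⁻¹ • ContinuousLinearMap.id ℝ ℂ)) w := by
  have h1 : (fun w : ℂ => Real.log ‖w‖) = fun w => (1 / 2 : ℝ) * Real.log (‖w‖ ^ 2) := by
    ext v; rw [Real.log_pow]; push_cast; ring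
  have hw' : ‖w‖ ^ 2 ≠ 0 := pow_ne_zero 2 (norm_ne_zero_iff.2 hw)
  rw [h1]
  refine ((((hasFDerivAt_id (𝕜 := ℝ) w).norm_sq).log hw').const_mul (1 / 2)).congr_fderiv ?_
  ext v
  simp only [smul_apply, ContinuousLinearMap.comp_apply,
    ContinuousLinearMap.id_apply, Complex.reCLM_apply, innerSL_apply_apply, Complex.inner,
    smul_eq_mul, nsmul_eq_mul, id, Complex.inv_def, Complex.mul_re, Complex.mul_im,
    Complex.conj_re, Complex.conj_im,
    Complex.ofReal_re, Complex.ofReal_im, ← Complex.normSq_eq_norm_sq]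
  push_cast
  ring

section Energy
variable {ι : Type*} [Fintype ι] [LinearOrder ι] [LocallyFiniteOrderTop ι]
  [LocallyFiniteOrderBot ι]

/-- The differential of the energy of point charges, expressed by the forces. -/
lemma hasFDerivAt_energy_sum (Q : ι → ℝ) {z : ι → ℂ} (hz : Function.Injective z) :
    ∃ L : (ι → ℂ) →L[ℝ] ℝ, HasFDerivAt (𝕜 := ℝ)
      (fun z : ι → ℂ => ∑ i, ∑ j ∈ Finset.Ioi i, Q i * Q j * Real.log ‖z i - z j‖) L z ∧
      ∀ v, L v = (∑ i, v i * ∑ j, (Q i * Q j : ℂ) * (1 / (z i - z j))).re := by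
  refine ⟨∑ i, ∑ j ∈ Finset.Ioi i, (Q i * Q j) • (Complex.reCLM.comp ((z i - z j)⁻¹ •
    ContinuousLinearMap.id ℝ ℂ)).comp 
    (ContinuousLinearMap.proj (R := ℝ) (φ := fun _ : ι => ℂ) i - ContinuousLinearMap.proj j),
    ?_, fun v => ?_⟩
  · refine HasFDerivAt.fun_sum fun i _ => HasFDerivAt.fun_sum fun j hj => ?_
    refine HasFDerivAt.const_mul ?_ _
    have hij : z i - z j ≠ 0 := sub_ne_zero.2 fun h => (Finset.mem_Ioi.1 hj).ne (hz h)
    have h1 : HasFDerivAt (𝕜 := ℝ) (fun z : ι → ℂ => z i - z j)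
        (ContinuousLinearMap.proj (R := ℝ) (φ := fun _ : ι => ℂ) i
          - ContinuousLinearMap.proj j) z :=
      (hasFDerivAt_apply i z).sub (hasFDerivAt_apply j z)
    exact (hasFDerivAt_log_norm hij).comp z h1
  -- The diagonal terms are zero because `1 / 0 = 0`; the others are paired as `(i, j)` and `(j,
  -- i)`.
  · have h1 : ∀ i, ∑ j, (Q i * Q j : ℂ) * (1 / (z i - z j))
        = ∑ j ∈ {i}ᶜ, (Q i * Q j : ℂ) * (1 / (z i - z j)) := by
      intro i
      refine (Finset.sum_subset (Finset.subset_univ _) fun j _ hj => ?_).symm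
      obtain rfl : j = i := by simpa using hj
      simp
    simp only [h1, Finset.mul_sum]
    rw [← Finset.sum_sum_Ioi_add_eq_sum_sum_off_diag
      (fun j i => v i * ((Q i * Q j : ℂ) * (1 / (z i - z j))))]
    simp only [sum_apply, Complex.re_sum]
    refine Finset.sum_congr rfl fun i _ => Finset.sum_congr rfl fun j hj => ?_
    have h2 : v j * ((Q j * Q i : ℂ) * (1 / (z j - z i)))
        = -(v j * ((Q i * Q j : ℂ) * (z i - z j)⁻¹)) := by
      rw [← neg_sub (z i) (z j), one_div, inv_neg]; ring
    have h3 : v i * ((Q i * Q j : ℂ) * (1 / (z i - z j)))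
        + v j * ((Q j * Q i : ℂ) * (1 / (z j - z i)))
        = ((Q i * Q j : ℝ) : ℂ) * ((z i - z j)⁻¹ * (v i - v j)) := by
      rw [h2, one_div]; push_cast; ring
    rw [h3, Complex.re_ofReal_mul]; rfl

lemma hasFDerivAt_energy_sum_zero_iff (Q : ι → ℝ) {z : ι → ℂ} (hz : Function.Injective z) :
    HasFDerivAt (𝕜 := ℝ)
      (fun z : ι → ℂ => ∑ i, ∑ j ∈ Finset.Ioi i, Q i * Q j * Real.log ‖z i - z j‖)
      (0 : (ι → ℂ) →L[ℝ] ℝ) z ↔ ∀ i, ∑ j, (Q i * Q j : ℂ) * (1 / (z i - z j)) = 0 := by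
  obtain ⟨L, hL, hLv⟩ := hasFDerivAt_energy_sum Q hz
  set F : ι → ℂ := fun i => ∑ j, (Q i * Q j : ℂ) * (1 / (z i - z j)) with hF
  have hLF : ∀ v, L v = (∑ i, v i * F i).re := hLv
  constructor
  · intro h i
    -- Moving the charge `i` in the direction of the conjugate of its force `F i` gives `|F i|²` as
    -- the derivative.
    have h0 := hLF (Pi.single i ((starRingEnd ℂ) (F i)))
    rw [hL.unique h, Finset.sum_eq_single i
      (fun j _ hj => by rw [Pi.single_eq_of_ne hj, zero_mul]) (by simp),
      Pi.single_eq_same, mul_comm, Complex.mul_conj, Complex.ofReal_re] at h0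
    exact Complex.normSq_eq_zero.1 h0.symm
  · intro h
    have hL0 : L = 0 := by
      refine ContinuousLinearMap.ext fun v => ?_
      rw [hLF, Finset.sum_eq_zero fun i _ => by rw [show F i = 0 from h i, mul_zero]]
      rfl
    exact hL0 ▸ hL

end Energy

/-- The sum over the other roots of a polynomial at a simple root. -/
lemma sum_roots_eq_of_isRoot {p : ℂ[X]} (hp : p.Separable) {x : ℂ} (hx : p.eval x = 0) :
    2 * (p.roots.map fun w => 1 / (x - w)).sum * (derivative p).eval x
      = (derivative (derivative p)).eval x := by
  obtain ⟨r, hr⟩ := dvd_iff_isRoot.2 hx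
  have hrx : r.eval x ≠ 0 := by
    intro h0
    obtain ⟨u, v, huv⟩ := hp
    have h1 := congrArg (eval x) huv
    rw [hr] at h1
    simp [h0] at h1
  have hroots : p.roots = {x} + r.roots := by
    rw [hr, roots_mul (hr ▸ hp.ne_zero), roots_X_sub_C]
  have hlog := (IsAlgClosed.splits r).eval_derivative_div_eval_of_ne_zero hrx
  rw [hroots, Multiset.map_add, Multiset.sum_add, ← hlog, hr]
  simp
  field_simp
  ring

lemma eval_derivative_eq_sum_roots {q : ℂ[X]} {x : ℂ} (hx : q.eval x ≠ 0) :
    (derivative q).eval x = (q.roots.map fun w => 1 / (x - w)).sum * q.eval x := by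
  rw [← (IsAlgClosed.splits q).eval_derivative_div_eval_of_ne_zero hx, div_mul_cancel₀ _ hx]

lemma eval_derivative_ne_zero {p : ℂ[X]} (hp : p.Separable) {x : ℂ} (hx : p.eval x = 0) :
    (derivative p).eval x ≠ 0 := eval_ne_zero_of_isCoprime hp hx

lemma injective_of_nodup_map {α : Type*} {n : ℕ} {x : Fin n → α}
    (h : (Finset.univ.val.map x).Nodup) : Function.Injective x := fun i j hij =>
  Multiset.inj_on_of_nodup_map h i (Finset.mem_univ i) j (Finset.mem_univ j) hij

/-- At a root of `p` or `q` the force is a nonzero multiple of `s - 2 t`, with `s` and `t` the sums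
of `1 / (w - v)` over the roots of `p` and `q`. One sum is a logarithmic derivative and the other,
taken at a simple root, is half of the second derivative over the first. -/
lemma isEquilibrium_iff {p q : ℂ[X]} {n m : ℕ} {x : Fin n → ℂ} {y : Fin m → ℂ}
    (hp : p.Separable) (hq : q.Separable) (hpq : IsCoprime p q)
    (hx : p.roots = Finset.univ.val.map x) (hy : q.roots = Finset.univ.val.map y) :
    IsEquilibrium n m (Fin.append x y) ↔ bracket 2 p q = 0 := by
  have hx0 : ∀ w, p.eval w = 0 ↔ ∃ i, x i = w := fun w => by
    rw [← IsRoot.def, ← mem_roots hp.ne_zero, hx]; simp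
  have hy0 : ∀ w, q.eval w = 0 ↔ ∃ i, y i = w := fun w => by
    rw [← IsRoot.def, ← mem_roots hq.ne_zero, hy]; simp
  have hinj : Function.Injective (Fin.append x y) := by
    rw [Fin.append_injective_iff]
    refine ⟨injective_of_nodup_map (hx ▸ nodup_roots hp),
      injective_of_nodup_map (hy ▸ nodup_roots hq), fun i j hij => ?_⟩
    exact eval_ne_zero_of_isCoprime hpq ((hx0 _).2 ⟨i, rfl⟩) ((hy0 _).2 ⟨j, hij.symm⟩)
  have hsum : ∀ w, ∑ j, (charge n m j : ℂ) * (1 / (w - Fin.append x y j))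
      = (p.roots.map fun v => 1 / (w - v)).sum - 2 * (q.roots.map fun v => 1 / (w - v)).sum := by
    intro w
    rw [Fin.sum_univ_add, hx, hy, Multiset.map_map, Multiset.map_map]
    simp only [Fin.append_left, Fin.append_right, charge, Fin.val_castAdd, Fin.is_lt, if_true,
      Fin.val_natAdd, show ∀ i, ¬ n + i < n from fun i => by lia, if_false]
    rw [← Finset.mul_sum, ← Finset.mul_sum]
    push_cast
    rw [one_mul, neg_mul, ← sub_eq_add_neg]
    rfl
  have hcharge : ∀ i, (charge n m i : ℂ) ≠ 0 := fun i => by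
    rw [charge]; split_ifs <;> norm_num
  rw [IsEquilibrium, bracket_two_eq_zero_iff_eval hp hq hpq]
  refine (hasFDerivAt_energy_sum_zero_iff (charge n m) hinj).trans ?_
  have hforce : ∀ i, (∑ j, (charge n m i * charge n m j : ℂ) *
      (1 / (Fin.append x y i - Fin.append x y j)) = 0) ↔
      (p.roots.map fun v => 1 / (Fin.append x y i - v)).sum
        - 2 * (q.roots.map fun v => 1 / (Fin.append x y i - v)).sum = 0 := by
    intro i
    rw [← hsum]
    simp only [mul_assoc]
    rw [← Finset.mul_sum, mul_eq_zero, or_iff_right (hcharge i)]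
  simp only [hforce]
  rw [Fin.forall_fin_add]
  refine and_congr ?_ ?_
  · simp only [Fin.append_left]
    rw [show (∀ w, p.eval w = 0 → (q * derivative (derivative p)
      - 4 * (derivative p * derivative q)).eval w = 0) ↔ ∀ i, (q * derivative (derivative p)
      - 4 * (derivative p * derivative q)).eval (x i) = 0 by simp [hx0]]
    refine forall_congr' fun i => ?_
    have hpx := (hx0 _).2 ⟨i, rfl⟩
    have hqx := eval_ne_zero_of_isCoprime hpq hpx
    have hpx' := eval_derivative_ne_zero hp hpx
    simp only [eval_sub, eval_mul, eval_ofNat]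
    rw [← sum_roots_eq_of_isRoot hp hpx, eval_derivative_eq_sum_roots hqx]
    generalize (p.roots.map fun v => 1 / (x i - v)).sum = s
    generalize (q.roots.map fun v => 1 / (x i - v)).sum = t
    rw [show q.eval (x i) * (2 * s * (derivative p).eval (x i))
      - 4 * ((derivative p).eval (x i) * (t * q.eval (x i)))
      = (2 * q.eval (x i) * (derivative p).eval (x i)) * (s - 2 * t) by ring, mul_eq_zero,
      or_iff_right (mul_ne_zero (mul_ne_zero two_ne_zero hqx) hpx')]
  · simp only [Fin.append_right]
    rw [show (∀ w, q.eval w = 0 → (derivative p * derivative q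
      - p * derivative (derivative q)).eval w = 0) ↔ ∀ i, (derivative p * derivative q
      - p * derivative (derivative q)).eval (y i) = 0 by simp [hy0]]
    refine forall_congr' fun i => ?_
    have hqy := (hy0 _).2 ⟨i, rfl⟩
    have hpy := eval_ne_zero_of_isCoprime hpq.symm hqy
    have hqy' := eval_derivative_ne_zero hq hqy
    simp only [eval_sub, eval_mul]
    rw [← sum_roots_eq_of_isRoot hq hqy, eval_derivative_eq_sum_roots hpy]
    generalize (p.roots.map fun v => 1 / (y i - v)).sum = s
    generalize (q.roots.map fun v => 1 / (y i - v)).sum = t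
    rw [show s * p.eval (y i) * (derivative q).eval (y i)
      - p.eval (y i) * (2 * t * (derivative q).eval (y i))
      = (p.eval (y i) * (derivative q).eval (y i)) * (s - 2 * t) by ring, mul_eq_zero,
      or_iff_right (mul_ne_zero hpy hqy')]

end ChargeEquilibrium

theorem proposition1 :
    -- all solutions of the recurrences are polynomials, and the recurrences are always solvable:
    -- every holomorphic solution, complete or partial, on a domain is given by polynomials
    -- that belong to a complete polynomial solution
    (∀ (U : Set ℂ) (I : Set ℤ) (p q : ℤ → ℂ → ℂ), IsOpen U → IsConnected U →
      I.OrdConnected → Set.Icc (-1) 2 ⊆ I → ChargeEquilibrium.IsSolutionOn U I p q →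
      ∃ P Q : ℤ → ℂ[X], ChargeEquilibrium.IsPolynomialSolution P Q ∧
        (∀ i : ℤ, 2 * i + 1 ∈ I → ∀ z ∈ U, p i z = (P i).eval z) ∧
        (∀ i : ℤ, 2 * i ∈ I → ∀ z ∈ U, q i z = (Q i).eval z)) ∧
    -- degrees of the solutions, and the bilinear equations that they satisfy
    (∀ P Q : ℤ → ℂ[X], ChargeEquilibrium.IsPolynomialSolution P Q → ∀ i : ℤ,
      (P i).Monic ∧ (Q i).Monic ∧
      ((P i).natDegree : ℤ) = i * (3 * i + 2) ∧
      ((Q i).natDegree : ℤ) = i * (3 * i - 1) / 2 ∧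
      ChargeEquilibrium.bracket 2 (P i) (Q i) = 0 ∧
      ChargeEquilibrium.bracket 2 (P i) (Q (i + 1)) = 0) ∧
    -- for polynomials without common or repeated roots, with their roots listed in any order:
    -- the bilinear equation, the pairs from the recurrences, rationality of both integrals, and
    -- equilibrium of the charges are equivalent
    (∀ (p q : ℂ[X]) (n m : ℕ) (x : Fin n → ℂ) (y : Fin m → ℂ),
      Squarefree p → Squarefree q → IsCoprime p q →
      p.roots = Finset.univ.val.map x → q.roots = Finset.univ.val.map y →
      List.TFAE [
        ChargeEquilibrium.bracket 2 p q = 0,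
        ChargeEquilibrium.IsRecurrencePair p q,
        ChargeEquilibrium.HasRationalIntegral p (q ^ 2) ∧
          ChargeEquilibrium.HasRationalIntegral (q ^ 4) (p ^ 2),
        ChargeEquilibrium.IsEquilibrium n m (Fin.append x y)]) := by
  refine ⟨fun U I p q hU hconn hI hI2 h => h.exists_polynomial hU hconn hI hI2,
    fun P Q h i => ?_, fun p q n m x y hp hq hpq hx hy => ?_⟩
  · have hP := h.properties (2 * i + 1)
    have hQ := h.properties (2 * i)
    rw [ChargeEquilibrium.interleave_odd] at hP
    rw [ChargeEquilibrium.interleave_even] at hQ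
    refine ⟨hP.1, hQ.1, ?_, ?_, (h.bracket_eq_zero i).1, (h.bracket_eq_zero i).2⟩
    · rw [hP.2.1, ChargeEquilibrium.posDeg_odd]
    · rw [hQ.2.1, ChargeEquilibrium.posDeg_even]
  · have hp' := PerfectField.separable_iff_squarefree.2 hp
    have hq' := PerfectField.separable_iff_squarefree.2 hq
    tfae_have 1 → 2 := ChargeEquilibrium.isRecurrencePair_of_bracket hp' hq' hpq
    tfae_have 2 → 1 := ChargeEquilibrium.bracket_of_isRecurrencePair
    tfae_have 1 ↔ 3 :=
      ChargeEquilibrium.bracket_two_eq_zero_iff_hasRationalIntegral hp' hq' hpq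
    tfae_have 4 ↔ 1 := ChargeEquilibrium.isEquilibrium_iff hp' hq' hpq hx hy
    tfae_finish
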